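/- All graphs are finite, simple and undirected. For a graph $G$ with a linear order $\prec$ on $V(G)$, two edges $u_1v_1$ and $u_2v_2$ are in a nesting relation if, up to exchanging the two edges and renaming the endpoints of each edge, $u_1 \prec u_2 \prec v_2 \prec v_1$. For an integer $\ell \ge 1$, an $\ell$-page queue layout $\langle \prec_G, \sigma_G\rangle$ of $G$ consists of a linear order $\prec_G$ of $V(G)$ and a map $\sigma_G \colon E(G) \to \{1,\dots,\ell\}$ such that no two edges $e, f$ with $\sigma_G(e) = \sigma_G(f)$ are in a nesting relation. It extends an $\ell$-page queue layout $\langle \prec_H, \sigma_H\rangle$ of a subgraph $H \subseteq G$ if $\sigma_H(e) = \sigma_G(e)$ for all $e \in E(H)$ and $u \prec_H v \Leftrightarrow u \prec_G v$ for all $u, v \in V(H)$. The problem Queue Layout Extension asks, given an integer $\ell \ge 1$, a graph $G$, a subgraph $H$ of $G$ and an $\ell$-page queue layout $\langle \prec_H, \sigma_H\rangle$ of $H$, whether there exists an $\ell$-page queue layout of $G$ that extends $\langle \prec_H, \sigma_H\rangle$. The size of such an instance is $|V(G)| + |E(G)| + \ell$. Theorem. When restricted to the instances in which $H$ is obtained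 from $G$ by deleting two distinct vertices (of arbitrary degree) together with their incident edges, Queue Layout Extension can be solved in polynomial time; that is, there is a single algorithm that decides all these instances in a number of steps bounded by a polynomial in the size of the instance. -/

import Mathlib

/-! ### Queue layouts and the extension problem -/

namespace QueueLayoutExtension

/-- With respect to the strict order `lt`, the edge `e` nests the edge `f`: their endpoints are
arranged as `u₁ < u₂ < v₂ < v₁`, where `e = u₁v₁` and `f = u₂v₂`. -/
def Nests {V : Type*} (lt : V → V → Prop) (e f : Sym2 V) : Prop :=
  ∃ u₁ v₁ u₂ v₂ : V, e = s(u₁, v₁) ∧ f = s(u₂, v₂) ∧ lt u₁ u₂ ∧ lt u₂ v₂ ∧ lt v₂ v₁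

/-- An `ℓ`-page queue layout of `G`: a linear order of the vertices (the spine order, given as a
strict order) and an assignment of the edges to `ℓ` pages, such that no two edges on the same page
are in a nesting relation. The pages `1, …, ℓ` are represented by `0, …, ℓ - 1`. -/
structure QueueLayout {V : Type*} (G : SimpleGraph V) (ℓ : ℕ) where
  spine : V → V → Prop
  strictTotal : IsStrictTotalOrder V spine
  page : G.edgeSet → Fin ℓ
  not_nests : ∀ e f : G.edgeSet, page e = page f → ¬ Nests spine (e : Sym2 V) (f : Sym2 V)

/-- The edge of `G` joining two adjacent vertices. -/
def edgeOf {V : Type*} (G : SimpleGraph V) {x y : V} (h : G.Adj x y) : G.edgeSet :=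
  ⟨s(x, y), h⟩

/-- A queue layout of `G` extends a queue layout of a subgraph `H` of `G` if the spine orders
agree on the vertices of `H` and the page assignments agree on the edges of `H`. -/
def QueueLayout.Extends {V : Type*} {G : SimpleGraph V} {ℓ : ℕ} (L : QueueLayout G ℓ)
    {H : G.Subgraph} (K : QueueLayout H.coe ℓ) : Prop :=
  (∀ x y : H.verts, K.spine x y ↔ L.spine x y) ∧
  (∀ (x y : H.verts) (h : H.coe.Adj x y),
    L.page (edgeOf G (H.adj_sub h)) = K.page (edgeOf H.coe h))

/-- An instance of Queue Layout Extension: an integer `ℓ ≥ 1`, a finite graph `G` (with vertices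
numbered `0, …, n - 1`), a subgraph `H` of `G`, and an `ℓ`-page queue layout of `H`. -/
structure Instance where
  ℓ : ℕ
  one_le_ℓ : 1 ≤ ℓ
  n : ℕ
  G : SimpleGraph (Fin n)
  H : G.Subgraph
  layoutH : QueueLayout H.coe ℓ

namespace Instance

/-- The question: is there an `ℓ`-page queue layout of `G` that extends the given one of `H`? -/
def IsPositive (I : Instance) : Prop :=
  ∃ L : QueueLayout I.G I.ℓ, L.Extends I.layoutH

/-- `H` is obtained from `G` by deleting two vertices (together with all incident edges, and
nothing else). -/
def TwoMissingVertices (I : Instance) : Prop :=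
  ∃ u v : Fin I.n, u ≠ v ∧ I.H = (⊤ : I.G.Subgraph).deleteVerts {u, v}

/-- The size `|V(G)| + |E(G)| + ℓ` of an instance. -/
noncomputable def size (I : Instance) : ℕ :=
  I.n + I.G.edgeSet.ncard + I.ℓ

open Classical in
/-- `0` for a vertex that is not in `H`; otherwise the position `1, 2, …` of the vertex in the
spine order of `H`. -/
noncomputable def spineEntry (I : Instance) (x : Fin I.n) : ℕ :=
  if h : x ∈ I.H.verts then {y : I.H.verts | I.layoutH.spine y ⟨x, h⟩}.ncard + 1 else 0

open Classical in
/-- Entry of the adjacency matrix of `G`. -/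
noncomputable def adjEntry (I : Instance) (x y : Fin I.n) : ℕ :=
  if I.G.Adj x y then 1 else 0

open Classical in
/-- `0` for a pair that is not an edge of `H`; otherwise the page `1, …, ℓ` of that edge. -/
noncomputable def pageEntry (I : Instance) (x y : Fin I.n) : ℕ :=
  if h : I.H.Adj x y then
    (I.layoutH.page (edgeOf I.H.coe (x := ⟨x, I.H.edge_vert h⟩)
      (y := ⟨y, I.H.edge_vert h.symm⟩) h)).val + 1
  else 0

/-- The entries of an `n × n` matrix, row by row. -/
def matrixEntries {n : ℕ} (M : Fin n → Fin n → ℕ) : List ℕ :=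
  (List.ofFn fun x => List.ofFn fun y => M x y).flatten

/-- The instance as an input list: `ℓ`, `n`, the spine entries of the vertices, the adjacency
matrix of `G`, the page matrix of `H`. It has `2 + n + 2n²` entries, each at most the size of the
instance. -/
noncomputable def encode (I : Instance) : List ℕ :=
  [I.ℓ, I.n] ++ List.ofFn I.spineEntry ++ matrixEntries I.adjEntry ++ matrixEntries I.pageEntry

end Instance

end QueueLayoutExtension

/-! ### Random access machines and polynomial time -/

namespace RAM

/-- Programs of a unit-cost random access machine with registers and arrays holding natural
numbers. A program mentions only finitely many registers and arrays. The arithmetic is addition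
and truncated subtraction only (no multiplication), so that numbers gain at most one bit per step
and polynomial time has its usual, machine-independent meaning. -/
inductive Program : Type
  /-- `R[i] := c` -/
  | const (i c : ℕ)
  /-- `R[i] := R[j] + R[k]` -/
  | add (i j k : ℕ)
  /-- `R[i] := R[j] - R[k]`, truncated at `0` -/
  | sub (i j k : ℕ)
  /-- `R[i] := A_a[R[j]]` -/
  | load (i a j : ℕ)
  /-- `A_a[R[i]] := R[j]` -/
  | store (a i j : ℕ)
  /-- first `P`, then `Q` -/
  | seq (P Q : Program)
  /-- if `R[i] ≤ R[j]` then `P` else `Q` -/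
  | ifLe (i j : ℕ) (P Q : Program)
  /-- while `R[i] < R[j]` do `P` -/
  | whileLt (i j : ℕ) (P : Program)

/-- A memory state: the content of each register, and of each cell of each array. -/
structure State where
  reg : ℕ → ℕ
  arr : ℕ → ℕ → ℕ

/-- Write a value into a register. -/
def State.setReg (s : State) (i v : ℕ) : State :=
  { s with reg := Function.update s.reg i v }

/-- Write a value into an array cell. -/
def State.setArr (s : State) (a k v : ℕ) : State :=
  { s with arr := Function.update s.arr a (Function.update (s.arr a) k v) }

/-- `Runs P s t s'`: started in state `s`, the program `P` halts in state `s'` after exactly `t`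
steps. Every executed elementary instruction and every evaluated test counts as one step. -/
inductive Runs : Program → State → ℕ → State → Prop
  | const (i c : ℕ) (s : State) : Runs (.const i c) s 1 (s.setReg i c)
  | add (i j k : ℕ) (s : State) : Runs (.add i j k) s 1 (s.setReg i (s.reg j + s.reg k))
  | sub (i j k : ℕ) (s : State) : Runs (.sub i j k) s 1 (s.setReg i (s.reg j - s.reg k))
  | load (i a j : ℕ) (s : State) : Runs (.load i a j) s 1 (s.setReg i (s.arr a (s.reg j)))
  | store (a i j : ℕ) (s : State) : Runs (.store a i j) s 1 (s.setArr a (s.reg i) (s.reg j))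
  | seq {P Q : Program} {s s' s'' : State} {t t' : ℕ} (hP : Runs P s t s')
      (hQ : Runs Q s' t' s'') : Runs (.seq P Q) s (t + t') s''
  | ifTrue {i j : ℕ} {P : Program} (Q : Program) {s s' : State} {t : ℕ}
      (h : s.reg i ≤ s.reg j) (hP : Runs P s t s') : Runs (.ifLe i j P Q) s (t + 1) s'
  | ifFalse {i j : ℕ} (P : Program) {Q : Program} {s s' : State} {t : ℕ}
      (h : ¬ s.reg i ≤ s.reg j) (hQ : Runs Q s t s') : Runs (.ifLe i j P Q) s (t + 1) s'
  | whileDone {i j : ℕ} (P : Program) {s : State}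
      (h : ¬ s.reg i < s.reg j) : Runs (.whileLt i j P) s 1 s
  | whileStep {i j : ℕ} {P : Program} {s s' s'' : State} {t t' : ℕ}
      (h : s.reg i < s.reg j) (hP : Runs P s t s') (hW : Runs (.whileLt i j P) s' t' s'') :
      Runs (.whileLt i j P) s (t + t' + 1) s''

/-- The initial state: the input list stands in array `0`, its length in register `0`, and
everything else is `0`. -/
def initState (w : List ℕ) : State where
  reg := fun i => if i = 0 then w.length else 0
  arr := fun a k => if a = 0 then w.getD k 0 else 0

/-- The program halts on the input `w` within `T` steps, with output (in register `0`) equal to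
`1` if `Q` holds and equal to `0` otherwise. -/
def DecidesWithin (P : Program) (w : List ℕ) (T : ℕ) (Q : Prop) : Prop :=
  ∃ (t : ℕ) (s : State), Runs P (initState w) t s ∧ t ≤ T ∧
    ((Q ∧ s.reg 0 = 1) ∨ (¬ Q ∧ s.reg 0 = 0))

/-- The decision problem with instances `α`, input encoding `enc`, size measure `size` and
positive instances `yes`, restricted to the instances satisfying `dom`, is solvable in polynomial
time: one program decides all these instances, in a number of steps bounded by a polynomial in
their size. -/
def SolvableInPolyTime {α : Type*} (enc : α → List ℕ) (size : α → ℕ) (dom yes : α → Prop) :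
    Prop :=
  ∃ (P : Program) (p : Polynomial ℕ), ∀ I : α, dom I →
    DecidesWithin P (enc I) (p.eval (size I)) (yes I)

end RAM

/-! Up to order, a new vertex is placed by the number of old vertices before it, so there are
polynomially many placements to try. Fix one, with the new vertices at `α < β`. The edge between
them shares an endpoint with every other new edge, so it only has to avoid nesting with old edges.
Every other new edge has a list of pages on which it nests with no old edge. Two edges `αx` and `βy`
nest exactly when `y < α` and `y < x < β`, or, in mirror image, when `x > β` and `α < y < x`. These
cases involve disjoint sets of edges, so the problem splits into two independent list assignments of
the same shape (`starCriterion_both`).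

In one of them, far edges `βy` with `y < α` and near edges `αx` with `x < β` need different pages
whenever `y < x`. Suppose `x < x₀ < α` and page `p` is free for `αx₀` but not for `αx`. The blocking
old edge lies between `x` and `α`, hence inside `βy` for all `y < x`, so `p` is useless for those
far edges. Going down from `α`, the current page `q` is therefore kept until a near point `z`
refuses it; below `z` the page `q` no longer matters, and the state of the recursion is `z` alone
(`assignable_iff_of_recursion`). For near points between `α` and `β` similar geometry shows that
guessing one page `q₀` suffices (`exists_assignment_iff`).

For the running time, the criterion is written as one fixed formula with bounded quantifiers and
tables for the recursion. `Formula.decides` compiles every such formula into a polynomial-time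
program. -/

namespace RAM

/-! ### Rules for correctness and running time of programs. -/

/-- Started in `s`, the program halts within `T` steps in a state satisfying `Q`. -/
def Ends (P : Program) (s : State) (T : ℕ) (Q : State → Prop) : Prop :=
  ∃ t s', Runs P s t s' ∧ t ≤ T ∧ Q s'

namespace Ends

variable {P P' : Program} {s : State} {T T' : ℕ} {Q R : State → Prop}

theorem mono (h : Ends P s T Q) (hT : T ≤ T') (hQ : ∀ s', Q s' → R s') : Ends P s T' R := by
  obtain ⟨t, s', hr, ht, hq⟩ := h
  exact ⟨t, s', hr, ht.trans hT, hQ _ hq⟩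

theorem seq (h : Ends P s T R) (h' : ∀ s', R s' → Ends P' s' T' Q) :
    Ends (.seq P P') s (T + T') Q := by
  obtain ⟨t, s', hr, ht, hq⟩ := h
  obtain ⟨t', s'', hr', ht', hq'⟩ := h' s' hq
  exact ⟨t + t', s'', .seq hr hr', by omega, hq'⟩

theorem const {i c : ℕ} (h : Q (s.setReg i c)) : Ends (.const i c) s 1 Q :=
  ⟨1, _, .const i c s, le_rfl, h⟩

theorem add {i j k : ℕ} (h : Q (s.setReg i (s.reg j + s.reg k))) : Ends (.add i j k) s 1 Q :=
  ⟨1, _, .add i j k s, le_rfl, h⟩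

theorem sub {i j k : ℕ} (h : Q (s.setReg i (s.reg j - s.reg k))) : Ends (.sub i j k) s 1 Q :=
  ⟨1, _, .sub i j k s, le_rfl, h⟩

theorem load {i a j : ℕ} (h : Q (s.setReg i (s.arr a (s.reg j)))) : Ends (.load i a j) s 1 Q :=
  ⟨1, _, .load i a j s, le_rfl, h⟩

theorem store {a i j : ℕ} (h : Q (s.setArr a (s.reg i) (s.reg j))) : Ends (.store a i j) s 1 Q :=
  ⟨1, _, .store a i j s, le_rfl, h⟩

theorem ifLe {i j : ℕ} (h : s.reg i ≤ s.reg j → Ends P s T Q)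
    (h' : ¬ s.reg i ≤ s.reg j → Ends P' s T Q) : Ends (.ifLe i j P P') s (T + 1) Q := by
  by_cases hc : s.reg i ≤ s.reg j
  · obtain ⟨t, s', hr, ht, hq⟩ := h hc
    exact ⟨t + 1, s', .ifTrue _ hc hr, by omega, hq⟩
  · obtain ⟨t, s', hr, ht, hq⟩ := h' hc
    exact ⟨t + 1, s', .ifFalse _ hc hr, by omega, hq⟩

/-- A counting loop, with an invariant indexed by the value of the counter. -/
theorem whileLt {i j N : ℕ} (Inv : ℕ → State → Prop)
    (hreg : ∀ m s, Inv m s → s.reg i = m ∧ s.reg j = N)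
    (hstep : ∀ m < N, ∀ s, Inv m s → Ends P s T (Inv (m + 1))) (h0 : Inv 0 s) :
    Ends (.whileLt i j P) s (N * (T + 1) + 1) (Inv N) := by
  have key : ∀ r m s, m + r = N → Inv m s →
      Ends (.whileLt i j P) s (r * (T + 1) + 1) (Inv N) := by
    intro r
    induction r with
    | zero =>
      intro m s hm hI
      obtain ⟨h1, h2⟩ := hreg m s hI
      obtain rfl : m = N := by omega
      exact ⟨1, s, .whileDone _ (by omega), by omega, hI⟩
    | succ r ih =>
      intro m s hm hI
      obtain ⟨h1, h2⟩ := hreg m s hI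
      obtain ⟨t, s', hr, ht, hq⟩ := hstep m (by omega) s hI
      obtain ⟨t', s'', hr', ht', hq'⟩ := ih (m + 1) s' (by omega) hq
      refine ⟨t + t' + 1, s'', .whileStep (by omega) hr hr', ?_, hq'⟩
      have : (r + 1) * (T + 1) = r * (T + 1) + T + 1 := by ring
      omega
  exact key N 0 s (by omega) h0

end Ends

/-! ### Terms and formulas with bounded quantifiers -/

/-- Terms over numbered variables and an input array. -/
inductive Term : Type
  | var (i : ℕ)
  | const (c : ℕ)
  | inp (t : Term)
  | add (s t : Term)
  | sub (s t : Term)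
  | mul (s t : Term)

/-- Formulas with bounded quantifiers. A binder at depth `k` binds the variable number `k`.
`letTab b B R` binds a table of length `b`, whose entries are given by `B` with access to the
earlier entries, and evaluates `R`. -/
inductive Formula : Type
  | le (s t : Term)
  | lt (s t : Term)
  | eq (s t : Term)
  | tab (i : ℕ) (t : Term)
  | not (F : Formula)
  | and (F G : Formula)
  | or (F G : Formula)
  | imp (F G : Formula)
  | ex (b : Term) (F : Formula)
  | all (b : Term) (F : Formula)
  | letTab (b : Term) (B R : Formula)

/-- An environment gives every variable a value and a table. -/
abbrev Env := List (ℕ × List Prop)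

def Env.val (e : Env) (i : ℕ) : ℕ := (e.getD i (0, [])).1

def Env.table (e : Env) (i : ℕ) : List Prop := (e.getD i (0, [])).2

def Term.eval (w : ℕ → ℕ) (e : Env) : Term → ℕ
  | var i => e.val i
  | const c => c
  | inp t => w (t.eval w e)
  | add s t => s.eval w e + t.eval w e
  | sub s t => s.eval w e - t.eval w e
  | mul s t => s.eval w e * t.eval w e

/-- The table of length `N` given by a course-of-values recursion. -/
def tabulate (B : ℕ → List Prop → Prop) : ℕ → List Prop
  | 0 => []
  | N + 1 => tabulate B N ++ [B N (tabulate B N)]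

def Formula.holds (w : ℕ → ℕ) : Formula → Env → Prop
  | le s t, e => s.eval w e ≤ t.eval w e
  | lt s t, e => s.eval w e < t.eval w e
  | eq s t, e => s.eval w e = t.eval w e
  | tab i t, e => (e.table i).getD (t.eval w e) False
  | not F, e => ¬ F.holds w e
  | and F G, e => F.holds w e ∧ G.holds w e
  | or F G, e => F.holds w e ∨ G.holds w e
  | imp F G, e => F.holds w e → G.holds w e
  | ex b F, e => ∃ x < b.eval w e, F.holds w (e ++ [(x, [])])
  | all b F, e => ∀ x < b.eval w e, F.holds w (e ++ [(x, [])])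
  | letTab b B R, e =>
    R.holds w (e ++ [(b.eval w e, tabulate (fun z l => B.holds w (e ++ [(z, l)])) (b.eval w e))])

@[simp]
theorem length_tabulate (B : ℕ → List Prop → Prop) (N : ℕ) : (tabulate B N).length = N := by
  induction N with
  | zero => rfl
  | succ N ih => simp [tabulate, ih]

/-- Lengthening a table never changes its earlier entries, so a table can be filled in place and
read as a recursion. -/
theorem getD_tabulate (B : ℕ → List Prop → Prop) (N z : ℕ) :
    (tabulate B N).getD z False ↔ z < N ∧ B z (tabulate B z) := by
  induction N with
  | zero => simp [tabulate]
  | succ N ih =>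
    rcases lt_trichotomy z N with h | rfl | h
    · rw [tabulate, List.getD_append _ _ _ _ (by simpa using h), ih]
      simp [h, h.trans (Nat.lt_succ_self N)]
    · rw [tabulate, List.getD_append_right _ _ _ _ (by simp)]
      simp
    · rw [tabulate, List.getD_eq_default _ _ (by simp; omega)]
      simp; omega

open Classical in
/-- The truth value of a proposition, as a number. -/
noncomputable def bit (p : Prop) : ℕ := if p then 1 else 0

theorem bit_pos {p : Prop} (h : p) : bit p = 1 := if_pos h

theorem bit_neg {p : Prop} (h : ¬ p) : bit p = 0 := if_neg h

theorem bit_le_zero {p : Prop} : bit p ≤ 0 ↔ ¬ p := by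
  unfold bit; split <;> simp_all

/-! ### Memory representation of environments -/

/-- The variable `i` stands in register `4 * i`, the length of its table in register `4 * i + 3`,
and its table in array `i + 1`. -/
structure Rep (k : ℕ) (w : ℕ → ℕ) (e : Env) (s : State) : Prop where
  length : e.length = k
  inp : s.arr 0 = w
  val : ∀ i < k, s.reg (4 * i) = e.val i
  len : ∀ i < k, s.reg (4 * i + 3) = (e.table i).length
  table : ∀ i < k, ∀ z < (e.table i).length,
    s.arr (i + 1) z = bit ((e.table i).getD z False)

/-- Registers from `4 * k` on and arrays beyond `k` are scratch space for code at depth `k`. -/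
theorem Rep.congr {k : ℕ} {w : ℕ → ℕ} {e : Env} {s s' : State} (h : Rep k w e s)
    (hr : ∀ i < 4 * k, s'.reg i = s.reg i) (ha : ∀ a ≤ k, s'.arr a = s.arr a) : Rep k w e s' where
  length := h.length
  inp := by rw [ha 0 (by omega), h.inp]
  val i hi := by rw [hr _ (by omega), h.val i hi]
  len i hi := by rw [hr _ (by omega), h.len i hi]
  table i hi z hz := by rw [ha _ (by omega), h.table i hi z hz]

theorem Rep.extend {k : ℕ} {w : ℕ → ℕ} {e : Env} {s : State} (h : Rep k w e s) {x : ℕ}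
    {l : List Prop} (hx : s.reg (4 * k) = x) (hl : s.reg (4 * k + 3) = l.length)
    (ht : ∀ z < l.length, s.arr (k + 1) z = bit (l.getD z False)) :
    Rep (k + 1) w (e ++ [(x, l)]) s := by
  have hlen := h.length
  have hlt : ∀ i < k, (e ++ [(x, l)]).getD i (0, []) = e.getD i (0, []) := fun i hi =>
    List.getD_append _ _ _ _ (by omega)
  have heq : (e ++ [(x, l)]).getD k (0, []) = (x, l) := by
    rw [List.getD_append_right _ _ _ _ (by omega)]; simp [hlen]
  refine ⟨by simp [hlen], h.inp, ?_, ?_, ?_⟩ <;> intro i hi <;>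
    rcases Nat.lt_succ_iff_lt_or_eq.mp hi with hi | rfl
  · have := h.val i hi
    simpa only [Env.val, hlt i hi] using this
  · simpa only [Env.val, heq] using hx
  · have := h.len i hi
    simpa only [Env.table, hlt i hi] using this
  · simpa only [Env.table, heq] using hl
  · have := h.table i hi
    simpa only [Env.table, hlt i hi] using this
  · simpa only [Env.table, heq] using ht

/-- All variables and all input entries are at most `M`. -/
def Bounded (M : ℕ) (w : ℕ → ℕ) (e : Env) : Prop :=
  (∀ x ∈ e, x.1 ≤ M) ∧ ∀ j, w j ≤ M

theorem Bounded.val {M : ℕ} {w : ℕ → ℕ} {e : Env} (h : Bounded M w e) (i : ℕ) : e.val i ≤ M := by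
  unfold Env.val
  rcases lt_or_ge i e.length with hi | hi
  · rw [List.getD_eq_getElem _ _ hi]
    exact h.1 _ (List.getElem_mem hi)
  · rw [List.getD_eq_default _ _ hi]
    exact Nat.zero_le M

theorem Bounded.extend {M M' : ℕ} {w : ℕ → ℕ} {e : Env} (h : Bounded M w e) (hM : M ≤ M') {x : ℕ}
    (hx : x ≤ M') (l : List Prop) : Bounded M' w (e ++ [(x, l)]) := by
  refine ⟨?_, fun j => (h.2 j).trans hM⟩
  intro y hy
  rcases List.mem_append.mp hy with hy | hy
  · exact (h.1 y hy).trans hM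
  · obtain rfl := List.mem_singleton.mp hy
    exact hx

/-- A number-valued function of the environment can be computed in polynomial time, into any
register that is not occupied by the environment. -/
def Computes (k : ℕ) (f : (ℕ → ℕ) → Env → ℕ) : Prop :=
  ∀ r, 4 * k ≤ r → ∃ (P : Program) (p : Polynomial ℕ), ∀ M w e s, Rep k w e s → Bounded M w e →
    -- The value is bounded along with the time, since it may become a loop bound or the range of a
    -- variable.
    f w e ≤ p.eval M ∧ Ends P s (p.eval M) fun s' =>
      s'.reg r = f w e ∧ (∀ i < r, s'.reg i = s.reg i) ∧ s'.arr = s.arr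

/-- A property of the environment can be decided in polynomial time. -/
def Decides (k : ℕ) (φ : (ℕ → ℕ) → Env → Prop) : Prop :=
  ∃ (P : Program) (p : Polynomial ℕ), ∀ M w e s, Rep k w e s → Bounded M w e →
    Ends P s (p.eval M) fun s' => s'.reg (4 * k) = bit (φ w e) ∧
      (∀ i < 4 * k, s'.reg i = s.reg i) ∧ ∀ a ≤ k, s'.arr a = s.arr a

theorem State.setReg_reg (s : State) (i v j : ℕ) :
    (s.setReg i v).reg j = if j = i then v else s.reg j := by
  simp [State.setReg, Function.update_apply]

theorem State.setReg_arr (s : State) (i v : ℕ) : (s.setReg i v).arr = s.arr := rfl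

theorem State.setArr_reg (s : State) (a k v : ℕ) : (s.setArr a k v).reg = s.reg := rfl

theorem State.setArr_arr (s : State) (a k v b z : ℕ) :
    (s.setArr a k v).arr b z = if b = a ∧ z = k then v else s.arr b z := by
  by_cases hb : b = a
  · subst hb
    simp [State.setArr, Function.update_apply]
  · simp [State.setArr, hb]

theorem State.setArr_arr_ne (s : State) (a k v : ℕ) {b : ℕ} (hb : b ≠ a) :
    (s.setArr a k v).arr b = s.arr b := by
  simp [State.setArr, hb]

/-! ### Compiling terms. -/

namespace Computes

variable {k : ℕ} {f g : (ℕ → ℕ) → Env → ℕ}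

theorem const (c : ℕ) : Computes k fun _ _ => c := by
  intro r hr
  refine ⟨.const r c, .C (c + 1), fun M w e s hs hM => ⟨by simp, ?_⟩⟩
  refine (Ends.const (Q := fun s' => _) ?_).mono (by simp) fun _ h => h
  refine ⟨by simp [State.setReg_reg], fun i hi => ?_, rfl⟩
  simp [State.setReg_reg, hi.ne]

theorem var (i : ℕ) (hi : i < k) : Computes k fun _ e => e.val i := by
  intro r hr
  refine ⟨.seq (.const r 0) (.add r r (4 * i)), .X + 2, fun M w e s hs hM => ⟨?_, ?_⟩⟩
  · have := hM.val i
    simp; omega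
  refine Ends.mono (T := 1 + 1) (Ends.seq (Ends.const (Q := fun s' => s' = s.setReg r 0) rfl) ?_)
    (by simp) fun _ h => h
  rintro _ rfl
  refine Ends.add ⟨?_, fun i hi => ?_, rfl⟩
  · show _ = e.val i
    rw [← hs.val i hi]
    simp only [State.setReg_reg]
    have : 4 * i ≠ r := by omega
    simp [this]
  · simp [State.setReg_reg, hi.ne]

theorem inp (hf : Computes k f) : Computes k fun w e => w (f w e) := by
  intro r hr
  obtain ⟨P, p, hP⟩ := hf r hr
  refine ⟨.seq P (.load r 0 r), p + .X + 1, fun M w e s hs hM => ⟨?_, ?_⟩⟩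
  · have := hM.2 (f w e)
    simp; omega
  refine (Ends.seq (T' := 1) (hP M w e s hs hM).2 fun s' hs' => Ends.load
    (Q := fun s' => s'.reg r = w (f w e) ∧ (∀ i < r, s'.reg i = s.reg i) ∧ s'.arr = s.arr)
    ⟨?_, fun i hi => ?_, hs'.2.2⟩).mono (by simp) fun _ h => h
  · rw [State.setReg_reg, if_pos rfl, hs'.1, hs'.2.2, hs.inp]
  · simp [State.setReg_reg, hi.ne, hs'.2.1 i hi]

/-- Evaluate two terms, in two consecutive registers. -/
theorem both (hf : Computes k f) (hg : Computes k g) {r : ℕ} (hr : 4 * k ≤ r) :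
    ∃ (P : Program) (p : Polynomial ℕ), ∀ M w e s, Rep k w e s → Bounded M w e →
      f w e ≤ p.eval M ∧ g w e ≤ p.eval M ∧ Ends P s (p.eval M) fun s' =>
        s'.reg r = f w e ∧ s'.reg (r + 1) = g w e ∧
        (∀ i < r, s'.reg i = s.reg i) ∧ s'.arr = s.arr := by
  obtain ⟨P, p, hP⟩ := hf r hr
  obtain ⟨P', p', hP'⟩ := hg (r + 1) (by omega)
  refine ⟨.seq P P', p + p', fun M w e s hs hM => ?_⟩
  obtain ⟨h1, h2⟩ := hP M w e s hs hM
  have h3 := (hP' M w e s hs hM).1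
  refine ⟨by simp; omega, by simp; omega, ?_⟩
  rw [Polynomial.eval_add]
  refine Ends.seq h2 fun s' hs' => (hP' M w e s' (hs.congr (fun i hi => hs'.2.1 i (by omega))
    fun a _ => by rw [hs'.2.2]) hM).2.mono le_rfl fun s'' hs'' => ?_
  refine ⟨?_, hs''.1, fun i hi => ?_, hs''.2.2.trans hs'.2.2⟩
  · rw [hs''.2.1 r (by omega), hs'.1]
  · rw [hs''.2.1 i (by omega), hs'.2.1 i hi]

theorem add (hf : Computes k f) (hg : Computes k g) : Computes k fun w e => f w e + g w e := by
  intro r hr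
  obtain ⟨P, p, hP⟩ := both hf hg hr
  refine ⟨.seq P (.add r r (r + 1)), 2 * p + 1, fun M w e s hs hM => ?_⟩
  obtain ⟨h1, h2, h3⟩ := hP M w e s hs hM
  refine ⟨by simp; omega, ?_⟩
  refine (Ends.seq (T' := 1) h3 fun s' hs' => Ends.add
    (Q := fun s' => s'.reg r = f w e + g w e ∧ (∀ i < r, s'.reg i = s.reg i) ∧ s'.arr = s.arr)
    ⟨?_, fun i hi => ?_, hs'.2.2.2⟩).mono (by simp; omega) fun _ h => h
  · rw [State.setReg_reg, if_pos rfl, hs'.1, hs'.2.1]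
  · simp [State.setReg_reg, hi.ne, hs'.2.2.1 i hi]

theorem sub (hf : Computes k f) (hg : Computes k g) : Computes k fun w e => f w e - g w e := by
  intro r hr
  obtain ⟨P, p, hP⟩ := both hf hg hr
  refine ⟨.seq P (.sub r r (r + 1)), 2 * p + 1, fun M w e s hs hM => ?_⟩
  obtain ⟨h1, h2, h3⟩ := hP M w e s hs hM
  refine ⟨by simp; omega, ?_⟩
  refine (Ends.seq (T' := 1) h3 fun s' hs' => Ends.sub
    (Q := fun s' => s'.reg r = f w e - g w e ∧ (∀ i < r, s'.reg i = s.reg i) ∧ s'.arr = s.arr)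
    ⟨?_, fun i hi => ?_, hs'.2.2.2⟩).mono (by simp; omega) fun _ h => h
  · rw [State.setReg_reg, if_pos rfl, hs'.1, hs'.2.1]
  · simp [State.setReg_reg, hi.ne, hs'.2.2.1 i hi]

theorem mul (hf : Computes k f) (hg : Computes k g) : Computes k fun w e => f w e * g w e := by
  intro r hr
  obtain ⟨P, p, hP⟩ := both hf hg hr
  -- Repeated addition: `r + 2` accumulates while `r + 3` counts up to the second factor. The
  -- summand `p * p` is there for the size of the product; the time is linear in `p`.
  refine ⟨.seq P (.seq (.const (r + 2) 0) (.seq (.const (r + 3) 0)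
    (.seq (.whileLt (r + 3) (r + 1) (.seq (.add (r + 2) (r + 2) r)
      (.seq (.const (r + 4) 1) (.add (r + 3) (r + 3) (r + 4)))))
    (.seq (.const r 0) (.add r r (r + 2)))))), p * p + 5 * p + 5, fun M w e s hs hM => ?_⟩
  obtain ⟨h1, h2, h3⟩ := hP M w e s hs hM
  refine ⟨?_, ?_⟩
  · have := Nat.mul_le_mul h1 h2
    simp; omega
  refine (Ends.seq (T' := 1 + (1 + (g w e * (3 + 1) + 1 + (1 + 1)))) h3 fun s₁ hs₁ => ?_).mono
    (by simp; omega) fun _ h => h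
  let Inv : ℕ → State → Prop := fun m s' => s'.reg (r + 3) = m ∧ s'.reg (r + 1) = g w e ∧
    s'.reg r = f w e ∧ s'.reg (r + 2) = f w e * m ∧ (∀ i < r, s'.reg i = s.reg i) ∧ s'.arr = s.arr
  refine Ends.seq (Ends.const (Q := fun s' => s' = s₁.setReg (r + 2) 0) rfl) ?_
  rintro _ rfl
  refine Ends.seq (Ends.const (Q := Inv 0) ?_) fun s₂ hs₂ => ?_
  · refine ⟨?_, ?_, ?_, ?_, fun i hi => ?_, hs₁.2.2.2⟩ <;> simp [State.setReg_reg, hs₁]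
    rw [if_neg (by omega), if_neg (by omega), hs₁.2.2.1 i hi]
  refine Ends.seq (Ends.whileLt (N := g w e) Inv (fun m s h => ⟨h.1, h.2.1⟩) ?_ hs₂)
    fun s₃ hs₃ => ?_
  · intro m _ s' h'
    refine Ends.seq (T := 1) (T' := 1 + 1) (Ends.add rfl) ?_
    rintro _ rfl
    refine Ends.seq (Ends.const rfl) ?_
    rintro _ rfl
    refine Ends.add ?_
    obtain ⟨g1, g2, g3, g4, g5, g6⟩ := h'
    refine ⟨?_, ?_, ?_, ?_, fun i hi => ?_, g6⟩ <;> simp [State.setReg_reg, g1, g2, g3, g4]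
    · ring
    · rw [if_neg (by omega), if_neg (by omega), if_neg (by omega), g5 i hi]
  · obtain ⟨g1, g2, g3, g4, g5, g6⟩ := hs₃
    refine Ends.seq (Ends.const (Q := fun s' => s' = s₃.setReg r 0) rfl) ?_
    rintro _ rfl
    refine Ends.add ⟨?_, fun i hi => ?_, g6⟩ <;> simp [State.setReg_reg, g4]
    rw [if_neg hi.ne, if_neg hi.ne, g5 i hi]

end Computes

theorem Term.computes (k : ℕ) (t : Term) : Computes k fun w e => t.eval w e := by
  induction t with
  | var i =>
    by_cases hi : i < k
    · exact Computes.var i hi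
    · intro r hr
      obtain ⟨P, p, hP⟩ := Computes.const (k := k) 0 r hr
      refine ⟨P, p, fun M w e s hs hM => ?_⟩
      have : e.val i = 0 := by
        rw [Env.val, List.getD_eq_default _ _ (by rw [hs.length]; omega)]
      simpa only [Term.eval, this] using hP M w e s hs hM
  | const c => exact Computes.const c
  | inp t ih => exact ih.inp
  | add s t ihs iht => exact ihs.add iht
  | sub s t ihs iht => exact ihs.sub iht
  | mul s t ihs iht => exact ihs.mul iht

/-! ### Compiling formulas. -/

namespace Decides

variable {k : ℕ} {φ ψ χ : (ℕ → ℕ) → Env → Prop}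

theorem congr (h : Decides k φ) (hφ : ∀ w e, φ w e ↔ ψ w e) : Decides k ψ := by
  have : φ = ψ := by
    funext w e
    exact propext (hφ w e)
  exact this ▸ h

theorem true (k : ℕ) : Decides k fun _ _ => True := by
  refine ⟨.const (4 * k) 1, 1, fun M w e s hs hM => ?_⟩
  refine (Ends.const (Q := fun s' => _) ?_).mono (by simp) fun _ h => h
  refine ⟨by simp [State.setReg_reg, bit], fun i hi => ?_, fun _ _ => rfl⟩
  simp [State.setReg_reg, hi.ne]

theorem false (k : ℕ) : Decides k fun _ _ => False := by
  refine ⟨.const (4 * k) 0, 1, fun M w e s hs hM => ?_⟩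
  refine (Ends.const (Q := fun s' => _) ?_).mono (by simp) fun _ h => h
  refine ⟨by simp [State.setReg_reg, bit], fun i hi => ?_, fun _ _ => rfl⟩
  simp [State.setReg_reg, hi.ne]

/-- The propositional connectives are all instances of this one branching construct. -/
theorem ite (hφ : Decides k φ) (hψ : Decides k ψ) (hχ : Decides k χ) :
    Decides k fun w e => (φ w e → ψ w e) ∧ (¬ φ w e → χ w e) := by
  obtain ⟨P, p, hP⟩ := hφ
  obtain ⟨P₁, p₁, hP₁⟩ := hψ
  obtain ⟨P₂, p₂, hP₂⟩ := hχ
  refine ⟨.seq P (.seq (.const (4 * k + 1) 0) (.ifLe (4 * k) (4 * k + 1) P₂ P₁)),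
    p + p₁ + p₂ + 2, fun M w e s hs hM => ?_⟩
  refine (Ends.seq (T' := 1 + (p₁.eval M + p₂.eval M + 1)) (hP M w e s hs hM)
    fun s₁ hs₁ => ?_).mono (by simp; omega) fun _ h => h
  refine Ends.seq (Ends.const (Q := fun s' => s' = s₁.setReg (4 * k + 1) 0) rfl) ?_
  rintro _ rfl
  have hreg : ∀ i < 4 * k, (s₁.setReg (4 * k + 1) 0).reg i = s.reg i := fun i hi => by
    rw [State.setReg_reg, if_neg (by omega), hs₁.2.1 i hi]
  have hrep : Rep k w e (s₁.setReg (4 * k + 1) 0) := hs.congr hreg hs₁.2.2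
  have hval : (s₁.setReg (4 * k + 1) 0).reg (4 * k) ≤ (s₁.setReg (4 * k + 1) 0).reg (4 * k + 1) ↔
      ¬ φ w e := by
    rw [State.setReg_reg, State.setReg_reg, if_neg (by omega), if_pos rfl, hs₁.1, bit_le_zero]
  refine Ends.ifLe (fun h => ?_) (fun h => ?_) <;> rw [hval] at h
  · refine (hP₂ M w e _ hrep hM).mono (by omega) fun s' hs' =>
      ⟨by simpa [h] using hs'.1, fun i hi => (hs'.2.1 i hi).trans (hreg i hi),
        fun a ha => (hs'.2.2 a ha).trans (hs₁.2.2 a ha)⟩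
  · rw [not_not] at h
    refine (hP₁ M w e _ hrep hM).mono (by omega) fun s' hs' =>
      ⟨by simpa [h] using hs'.1, fun i hi => (hs'.2.1 i hi).trans (hreg i hi),
        fun a ha => (hs'.2.2 a ha).trans (hs₁.2.2 a ha)⟩

theorem not (hφ : Decides k φ) : Decides k fun w e => ¬ φ w e :=
  (hφ.ite (.false k) (.true k)).congr fun _ _ => by tauto

theorem and (hφ : Decides k φ) (hψ : Decides k ψ) : Decides k fun w e => φ w e ∧ ψ w e :=
  (hφ.ite hψ (.false k)).congr fun _ _ => by tauto

theorem or (hφ : Decides k φ) (hψ : Decides k ψ) : Decides k fun w e => φ w e ∨ ψ w e :=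
  (hφ.ite (.true k) hψ).congr fun _ _ => by tauto

theorem imp (hφ : Decides k φ) (hψ : Decides k ψ) : Decides k fun w e => φ w e → ψ w e :=
  (hφ.ite hψ (.true k)).congr fun _ _ => by tauto

theorem le {f g : (ℕ → ℕ) → Env → ℕ} (hf : Computes k f) (hg : Computes k g) :
    Decides k fun w e => f w e ≤ g w e := by
  obtain ⟨P, p, hP⟩ := Computes.both hf hg le_rfl
  refine ⟨.seq P (.ifLe (4 * k) (4 * k + 1) (.const (4 * k) 1) (.const (4 * k) 0)), p + 2,
    fun M w e s hs hM => ?_⟩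
  refine (Ends.seq (T' := 1 + 1) (hP M w e s hs hM).2.2
    fun s₁ ⟨h1, h2, h3, h4⟩ => ?_).mono (by simp) fun _ h => h
  refine Ends.ifLe (fun h => Ends.const ?_) (fun h => Ends.const ?_) <;> rw [h1, h2] at h
  all_goals
    refine ⟨by simp [State.setReg_reg, bit, h], fun i hi => ?_, fun a _ => by
      rw [State.setReg_arr, h4]⟩
    rw [State.setReg_reg, if_neg hi.ne, h3 i hi]

theorem lt {f g : (ℕ → ℕ) → Env → ℕ} (hf : Computes k f) (hg : Computes k g) :
    Decides k fun w e => f w e < g w e :=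
  (le hg hf).not.congr fun _ _ => not_le

theorem eq {f g : (ℕ → ℕ) → Env → ℕ} (hf : Computes k f) (hg : Computes k g) :
    Decides k fun w e => f w e = g w e :=
  ((le hf hg).and (le hg hf)).congr fun _ _ => le_antisymm_iff.symm

theorem tab {f : (ℕ → ℕ) → Env → ℕ} (i : ℕ) (hf : Computes k f) :
    Decides k fun w e => (e.table i).getD (f w e) False := by
  by_cases hi : i < k
  · obtain ⟨P, p, hP⟩ := hf (4 * k) le_rfl
    refine ⟨.seq P (.ifLe (4 * i + 3) (4 * k) (.const (4 * k) 0) (.load (4 * k) (i + 1) (4 * k))),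
      p + 2, fun M w e s hs hM => ?_⟩
    refine (Ends.seq (T' := 1 + 1) (hP M w e s hs hM).2
      fun s₁ ⟨h1, h2, h3⟩ => ?_).mono (by simp) fun _ h => h
    have hlen : s₁.reg (4 * i + 3) = (e.table i).length := by
      rw [h2 _ (by omega), hs.len i hi]
    refine Ends.ifLe (fun h => Ends.const ?_) (fun h => Ends.load ?_) <;> rw [h1, hlen] at h <;>
      refine ⟨?_, fun i hi => by rw [State.setReg_reg, if_neg hi.ne, h2 i hi],
        fun a _ => by rw [State.setReg_arr, h3]⟩
    · rw [State.setReg_reg, if_pos rfl, bit_neg]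
      show ¬ (e.table i).getD (f w e) False
      rw [List.getD_eq_default _ _ h]
      exact not_false
    · rw [State.setReg_reg, if_pos rfl, h1, h3, hs.table i hi _ (by omega)]
  · obtain ⟨P, p, hP⟩ := Decides.false k
    refine ⟨P, p, fun M w e s hs hM => ?_⟩
    have : (e.table i).getD (f w e) False = False := by
      rw [Env.table, List.getD_eq_default e _ (by rw [hs.length]; omega)]
      rfl
    simpa only [this] using hP M w e s hs hM

/-- The invariant of the search loop: the counter, the bound, the number of hits, and no table. -/
structure SearchInv (k N : ℕ) (p : ℕ → Prop) (s : State) (m : ℕ) (s' : State) : Prop where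
  counter : s'.reg (4 * k) = m
  bound : s'.reg (4 * k + 1) = N
  hits : 0 < s'.reg (4 * k + 2) ↔ ∃ x < m, p x
  len : s'.reg (4 * k + 3) = 0
  reg : ∀ i < 4 * k, s'.reg i = s.reg i
  arr : ∀ a ≤ k, s'.arr a = s.arr a

/-- The loop does not stop early: it adds up the truth values that the body leaves in register `4 *
k + 4`, and the sum is positive exactly when there is a witness. The body sees variables up to `M +
p(M)`, hence the composition of polynomials. -/
theorem ex {b : (ℕ → ℕ) → Env → ℕ} (hb : Computes k b) (hφ : Decides (k + 1) φ) :
    Decides k fun w e => ∃ x < b w e, φ w (e ++ [(x, [])]) := by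
  obtain ⟨P, p, hP⟩ := hb (4 * k + 1) (by omega)
  obtain ⟨P', p', hP'⟩ := hφ
  refine ⟨.seq P (.seq (.const (4 * k) 0) (.seq (.const (4 * k + 2) 0) (.seq (.const (4 * k + 3) 0)
    (.seq (.whileLt (4 * k) (4 * k + 1) (.seq P' (.seq (.add (4 * k + 2) (4 * k + 2) (4 * k + 4))
      (.seq (.const (4 * k + 4) 1) (.add (4 * k) (4 * k) (4 * k + 4))))))
    (.seq (.const (4 * k) 0) (.ifLe (4 * k + 2) (4 * k) (.const (4 * k) 0) (.const (4 * k) 1))))))),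
    p + (p * (p'.comp (.X + p) + 4)) + 7, fun M w e s hs hM => ?_⟩
  obtain ⟨h1, h2⟩ := hP M w e s hs hM
  refine (Ends.seq (T' := 1 + (1 + (1 + (b w e * (p'.eval (M + p.eval M) + 4) + 1 +
    (1 + (1 + 1)))))) h2 fun s₁ ⟨g1, g2, g3⟩ => ?_).mono ?_ fun _ h => h
  swap
  · have := Nat.mul_le_mul_right (p'.eval (M + p.eval M) + 4) h1
    simp
    omega
  let Inv := SearchInv k (b w e) (fun x => φ w (e ++ [(x, [])])) s
  refine Ends.seq (Ends.const (Q := fun s' => s' = s₁.setReg (4 * k) 0) rfl) ?_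
  rintro _ rfl
  refine Ends.seq (Ends.const rfl) ?_
  rintro _ rfl
  refine Ends.seq (Ends.const (Q := Inv 0) ?_) fun s₂ hs₂ => ?_
  · refine ⟨?_, ?_, ?_, ?_, fun i hi => ?_, fun a ha => ?_⟩ <;>
      simp [State.setReg_reg, State.setReg_arr, g1, g3]
    rw [if_neg (by omega), if_neg (by omega), if_neg (by omega), g2 i (by omega)]
  refine Ends.seq (Ends.whileLt (N := b w e) Inv (fun m s h => ⟨h.counter, h.bound⟩) ?_ hs₂)
    fun s₃ hs₃ => ?_
  · intro m hm s' h'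
    have hrep : Rep (k + 1) w (e ++ [(m, [])]) s' :=
      (hs.congr h'.reg h'.arr).extend h'.counter h'.len (fun z hz => absurd hz (by simp))
    refine Ends.seq (T := p'.eval (M + p.eval M)) (T' := 1 + (1 + 1)) (hP' (M + p.eval M) _ _ s' hrep
      (hM.extend (by omega) (by omega) _)) fun s₄ ⟨f1, f2, f3⟩ => ?_
    refine Ends.seq (Ends.add (Q := fun s' => s' = s₄.setReg _ _) rfl) ?_
    rintro _ rfl
    refine Ends.seq (Ends.const rfl) ?_
    rintro _ rfl
    refine Ends.add ?_
    have e0 : s₄.reg (4 * k + 4) = bit (φ w (e ++ [(m, [])])) := f1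
    have e1 : s₄.reg (4 * k) = m := (f2 _ (by omega)).trans h'.counter
    have e2 : s₄.reg (4 * k + 1) = b w e := (f2 _ (by omega)).trans h'.bound
    have e3 : s₄.reg (4 * k + 3) = 0 := (f2 _ (by omega)).trans h'.len
    have e4 : s₄.reg (4 * k + 2) = s'.reg (4 * k + 2) := f2 _ (by omega)
    refine ⟨?_, ?_, ?_, ?_, fun i hi => ?_, fun a ha => ?_⟩ <;>
      simp only [State.setReg_reg, State.setReg_arr]
    · simp [e1]
    · simp [e2]
    · have := h'.hits
      simp only [e0, e4]
      by_cases hc : φ w (e ++ [(m, [])])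
      · simpa [bit_pos hc] using ⟨m, by omega, hc⟩
      · rw [bit_neg hc]
        simp only [Nat.exists_lt_succ_right, hc, or_false]
        simpa using this
    · simp [e3]
    · rw [if_neg (by omega), if_neg (by omega), if_neg (by omega), f2 i (by omega), h'.reg i hi]
    · rw [f3 a (by omega), h'.arr a ha]
  · refine Ends.seq (Ends.const (Q := fun s' => s' = s₃.setReg (4 * k) 0) rfl) ?_
    rintro _ rfl
    have hv : s₃.reg (4 * k + 2) ≤ 0 ↔ ¬ ∃ x < b w e, φ w (e ++ [(x, [])]) := by
      rw [← hs₃.hits, not_lt]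
    refine Ends.ifLe (fun h => Ends.const ?_) (fun h => Ends.const ?_) <;>
      rw [State.setReg_reg, State.setReg_reg, if_neg (by omega), if_pos rfl, hv] at h <;>
      refine ⟨?_, fun i hi => ?_, fun a ha => hs₃.arr a ha⟩
    · rw [State.setReg_reg, if_pos rfl, bit_neg h]
    · rw [State.setReg_reg, if_neg hi.ne, State.setReg_reg, if_neg hi.ne, hs₃.reg i hi]
    · rw [State.setReg_reg, if_pos rfl, bit_pos (not_not.mp h)]
    · rw [State.setReg_reg, if_neg hi.ne, State.setReg_reg, if_neg hi.ne, hs₃.reg i hi]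

theorem all {b : (ℕ → ℕ) → Env → ℕ} (hb : Computes k b) (hφ : Decides (k + 1) φ) :
    Decides k fun w e => ∀ x < b w e, φ w (e ++ [(x, [])]) :=
  (ex hb hφ.not).not.congr fun _ _ => by push Not; rfl

/-- The invariant of the loop that fills a table. -/
structure FillInv (k N : ℕ) (B : ℕ → List Prop → Prop) (s : State) (m : ℕ) (s' : State) :
    Prop where
  counter : s'.reg (4 * k) = m
  bound : s'.reg (4 * k + 1) = N
  len : s'.reg (4 * k + 3) = m
  table : ∀ z < m, s'.arr (k + 1) z = bit ((tabulate B m).getD z False)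
  reg : ∀ i < 4 * k, s'.reg i = s.reg i
  arr : ∀ a ≤ k, s'.arr a = s.arr a

/-- While cell `m` is computed, the counter and the recorded table length are both `m`, so the body
sees precisely the earlier entries. After the loop both equal the bound, which is the environment
the final formula expects. -/
theorem letTab {b : (ℕ → ℕ) → Env → ℕ} (hb : Computes k b) (hφ : Decides (k + 1) φ)
    (hψ : Decides (k + 1) ψ) : Decides k fun w e =>
      ψ w (e ++ [(b w e, tabulate (fun z l => φ w (e ++ [(z, l)])) (b w e))]) := by
  obtain ⟨P, p, hP⟩ := hb (4 * k + 1) (by omega)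
  obtain ⟨P', p', hP'⟩ := hφ
  obtain ⟨P'', p'', hP''⟩ := hψ
  refine ⟨.seq P (.seq (.const (4 * k) 0) (.seq (.const (4 * k + 3) 0)
    (.seq (.whileLt (4 * k) (4 * k + 1) (.seq P' (.seq (.store (k + 1) (4 * k) (4 * k + 4))
      (.seq (.const (4 * k + 4) 1) (.seq (.add (4 * k) (4 * k) (4 * k + 4))
        (.add (4 * k + 3) (4 * k + 3) (4 * k + 4)))))))
    (.seq P'' (.seq (.const (4 * k) 0) (.add (4 * k) (4 * k) (4 * k + 4))))))),
    p + (p * (p'.comp (.X + p) + 5)) + p''.comp (.X + p) + 5, fun M w e s hs hM => ?_⟩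
  obtain ⟨h1, h2⟩ := hP M w e s hs hM
  refine (Ends.seq (T' := 1 + (1 + (b w e * (p'.eval (M + p.eval M) + 5) + 1 +
    (p''.eval (M + p.eval M) + (1 + 1))))) h2 fun s₁ ⟨g1, g2, g3⟩ => ?_).mono ?_ fun _ h => h
  swap
  · have := Nat.mul_le_mul_right (p'.eval (M + p.eval M) + 5) h1
    simp
    omega
  let B : ℕ → List Prop → Prop := fun z l => φ w (e ++ [(z, l)])
  let Inv := FillInv k (b w e) B s
  have hrep : ∀ m s', Inv m s' → Rep (k + 1) w (e ++ [(m, tabulate B m)]) s' := fun m s' h' =>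
    (hs.congr h'.reg h'.arr).extend h'.counter (by rw [h'.len, length_tabulate])
      (by rw [length_tabulate]; exact h'.table)
  refine Ends.seq (Ends.const (Q := fun s' => s' = s₁.setReg (4 * k) 0) rfl) ?_
  rintro _ rfl
  refine Ends.seq (Ends.const (Q := Inv 0) ?_) fun s₂ hs₂ => ?_
  · refine ⟨?_, ?_, ?_, fun z hz => absurd hz (by omega), fun i hi => ?_, fun a ha => ?_⟩ <;>
      simp [State.setReg_reg, State.setReg_arr, g1, g3]
    rw [if_neg (by omega), if_neg (by omega), g2 i (by omega)]
  refine Ends.seq (Ends.whileLt (N := b w e) Inv (fun m s h => ⟨h.counter, h.bound⟩) ?_ hs₂)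
    fun s₃ hs₃ => ?_
  · intro m hm s' h'
    refine Ends.seq (T := p'.eval (M + p.eval M)) (T' := 1 + (1 + (1 + 1)))
      (hP' (M + p.eval M) _ _ s' (hrep m s' h')
      (hM.extend (by omega) (by omega) _)) fun s₄ ⟨f1, f2, f3⟩ => ?_
    refine Ends.seq (Ends.store (Q := fun s' => s' = s₄.setArr _ _ _) rfl) ?_
    rintro _ rfl
    refine Ends.seq (Ends.const (Q := fun s' => s' = State.setReg _ _ _) rfl) ?_
    rintro _ rfl
    refine Ends.seq (Ends.add rfl) ?_
    rintro _ rfl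
    refine Ends.add ?_
    have e0 : s₄.reg (4 * k + 4) = bit (B m (tabulate B m)) := f1
    have e1 : s₄.reg (4 * k) = m := (f2 _ (by omega)).trans h'.counter
    have e2 : s₄.reg (4 * k + 1) = b w e := (f2 _ (by omega)).trans h'.bound
    have e3 : s₄.reg (4 * k + 3) = m := (f2 _ (by omega)).trans h'.len
    refine ⟨?_, ?_, ?_, fun z hz => ?_, fun i hi => ?_, fun a ha => ?_⟩ <;>
      simp only [State.setReg_reg, State.setReg_arr, State.setArr_reg]
    · simp [e1]
    · simp [e2]
    · simp [e3]
    · rw [State.setArr_arr, e1, e0]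
      simp only [true_and, getD_tabulate, hz]
      split_ifs with hzm
      · rw [hzm]
      · have hz' : z < m := by omega
        rw [f3 (k + 1) le_rfl, h'.table z hz', getD_tabulate, eq_true hz', true_and]
    · rw [if_neg (by omega), if_neg (by omega), if_neg (by omega), f2 i (by omega), h'.reg i hi]
    · rw [State.setArr_arr_ne _ _ _ _ (by omega), f3 a (by omega), h'.arr a ha]
  · refine Ends.seq (T := p''.eval (M + p.eval M)) (hP'' (M + p.eval M) _ _ s₃ (hrep _ _ hs₃)
      (hM.extend (by omega) (by omega) _)) fun s₄ ⟨f1, f2, f3⟩ => ?_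
    refine Ends.seq (Ends.const (Q := fun s' => s' = s₄.setReg (4 * k) 0) rfl) ?_
    rintro _ rfl
    have e0 : s₄.reg (4 * k + 4) = bit _ := f1
    refine Ends.add ⟨?_, fun i hi => ?_, fun a ha => ?_⟩
    · simp [State.setReg_reg, e0, B]
    · rw [State.setReg_reg, if_neg hi.ne, State.setReg_reg, if_neg hi.ne, f2 i (by omega),
        hs₃.reg i hi]
    · exact (f3 a (by omega)).trans (hs₃.arr a ha)

end Decides

theorem Formula.decides (F : Formula) : ∀ k, Decides k fun w e => F.holds w e := by
  induction F with
  | le s t => exact fun k => .le (s.computes k) (t.computes k)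
  | lt s t => exact fun k => .lt (s.computes k) (t.computes k)
  | eq s t => exact fun k => .eq (s.computes k) (t.computes k)
  | tab i t => exact fun k => .tab i (t.computes k)
  | not F ih => exact fun k => (ih k).not
  | and F G ihF ihG => exact fun k => (ihF k).and (ihG k)
  | or F G ihF ihG => exact fun k => (ihF k).or (ihG k)
  | imp F G ihF ihG => exact fun k => (ihF k).imp (ihG k)
  | ex b F ih => exact fun k => .ex (b.computes k) (ih (k + 1))
  | all b F ih => exact fun k => .all (b.computes k) (ih (k + 1))
  | letTab b B R ihB ihR => exact fun k => .letTab (b.computes k) (ihB (k + 1)) (ihR (k + 1))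

/-- A problem that is described by a formula, on inputs with small entries, is solvable in
polynomial time. -/
theorem solvableInPolyTime_of_formula {α : Type*} {enc : α → List ℕ} {size : α → ℕ}
    {dom yes : α → Prop} (F : Formula) (hsize : ∀ I, dom I → ∀ x ∈ enc I, x ≤ size I)
    (hF : ∀ I, dom I → (F.holds (fun j => (enc I).getD j 0) [] ↔ yes I)) :
    SolvableInPolyTime enc size dom yes := by
  obtain ⟨P, p, hP⟩ := F.decides 0
  refine ⟨P, p, fun I hI => ?_⟩
  have hb : Bounded (size I) (fun j => (enc I).getD j 0) [] := by
    refine ⟨by simp, fun j => ?_⟩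
    dsimp only
    rcases lt_or_ge j (enc I).length with hj | hj
    · rw [List.getD_eq_getElem _ _ hj]
      exact hsize I hI _ (List.getElem_mem hj)
    · rw [List.getD_eq_default _ _ hj]
      exact Nat.zero_le _
  -- At depth `0` no register is constrained, so the input length in register `0` does no harm, and
  -- the result register `4 * 0` is the output register.
  obtain ⟨t, s, hr, ht, hs, -⟩ := hP _ _ _ (initState (enc I))
    ⟨rfl, rfl, by simp, by simp, by simp⟩ hb
  refine ⟨t, s, hr, ht, ?_⟩
  rw [mul_zero] at hs
  rw [← hF I hI, hs]
  by_cases h : F.holds (fun j => (enc I).getD j 0) []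
  · exact .inl ⟨h, bit_pos h⟩
  · exact .inr ⟨h, bit_neg h⟩

end RAM

namespace QueueLayoutExtension

/-! ### Two stars on a line -/

section Stars

variable {P Q : ℕ → Prop} {LP LQ : ℕ → ℕ → Prop}

/-- The far edges, to the points of `P` below `t`, can be assigned pages from the lists `LP`, and
the near edges, to the points of `Q` below `t'`, pages from the lists `LQ`, such that no far edge
shares its page with a near edge to a larger point, and no far edge is on the page `q`. -/
def Assignable (P Q : ℕ → Prop) (LP LQ : ℕ → ℕ → Prop) (t t' q : ℕ) : Prop :=
  ∃ f g : ℕ → ℕ, (∀ y, P y → y < t → LP y (f y) ∧ f y ≠ q) ∧ (∀ x, Q x → x < t' → LQ x (g x)) ∧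
    ∀ y x, P y → Q x → y < t → x < t' → y < x → f y ≠ g x

/-- One step of the recursion for `Assignable`, downwards from `t`, where `q` is the page of the
current near edge and `S` describes which near points can be treated as the next one. -/
def Step (ℓ : ℕ) (P Q : ℕ → Prop) (LP LQ : ℕ → ℕ → Prop) (S : ℕ → Prop) (q t : ℕ) : Prop :=
  (∃ z < t, Q z ∧ ¬ LQ z q ∧ (∀ x < t, z < x → Q x → LQ x q) ∧
    (∀ y < t, z ≤ y → P y → ∃ p < ℓ, LP y p ∧ p ≠ q) ∧ S z) ∨
  ((∀ x < t, Q x → LQ x q) ∧ ∀ y < t, P y → ∃ p < ℓ, LP y p ∧ p ≠ q)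

theorem Step.congr {ℓ q t : ℕ} {S S' : ℕ → Prop} (h : ∀ z < t, S z ↔ S' z) :
    Step ℓ P Q LP LQ S q t ↔ Step ℓ P Q LP LQ S' q t :=
  or_congr_left <| exists_congr fun z => and_congr_right fun hz => by rw [h z hz]

/-- Let `z` be the largest near point below `t` that refuses `q`. Near points between `z` and `t`
can all take `q`, since far points below `t` avoid `q` anyway; far points in `[z, t)` then only have
to avoid `q`. By `hq` no far list below `z` contains `q`, so what remains is the subproblem at `z`,
independent of `q`. -/
theorem assignable_iff_step {t q ℓ : ℕ} {S : ℕ → Prop} (hℓ : ∀ y p, LP y p → p < ℓ)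
    (hq : ∀ x y, Q x → P y → x < t → y < x → ¬ LQ x q → ¬ LP y q)
    (hS : ∀ z, Q z → z < t → (S z ↔ Assignable P Q LP LQ z (z + 1) ℓ)) :
    Assignable P Q LP LQ t t q ↔ Step ℓ P Q LP LQ S q t := by
  classical
  constructor
  · rintro ⟨f, g, hf, hg, hfg⟩
    by_cases h : ∀ x, Q x → x < t → LQ x q
    · exact .inr ⟨fun x hxt hx => h x hx hxt,
        fun y hyt hy => ⟨f y, hℓ y _ (hf y hy hyt).1, hf y hy hyt⟩⟩
    · push Not at h
      obtain ⟨x₀, hx₀⟩ := h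
      let z := Nat.findGreatest (fun x => Q x ∧ x < t ∧ ¬ LQ x q) t
      obtain ⟨hz, hzt, hzq⟩ : Q z ∧ z < t ∧ ¬ LQ z q :=
        Nat.findGreatest_spec (P := fun x => Q x ∧ x < t ∧ ¬ LQ x q) hx₀.2.1.le hx₀
      refine .inl ⟨z, hzt, hz, hzq, fun x hxt hzx hx => ?_,
        fun y hyt _ hy => ⟨f y, hℓ y _ (hf y hy hyt).1, hf y hy hyt⟩, ?_⟩
      · by_contra hc
        exact Nat.findGreatest_is_greatest hzx hxt.le ⟨hx, hxt, hc⟩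
      · refine (hS z hz hzt).2 ⟨f, g, fun y hy hyz => ⟨(hf y hy (by omega)).1, fun h => ?_⟩,
          fun x hx hxz => hg x hx (by omega), fun y x hy hx hyz hxz => hfg y x hy hx (by omega)
          (by omega)⟩
        exact (hℓ y _ (hf y hy (by omega)).1).ne h
  · rintro (⟨z, hzt, hz, hzq, hQ, hP, hSz⟩ | ⟨hQ, hP⟩)
    · obtain ⟨f, g, hf, hg, hfg⟩ := (hS z hz hzt).1 hSz
      have hP' : ∀ y, ∃ p, P y → z ≤ y → y < t → LP y p ∧ p ≠ q := fun y => by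
        by_cases hy : P y ∧ z ≤ y ∧ y < t
        · obtain ⟨p, -, hp⟩ := hP y hy.2.2 hy.2.1 hy.1
          exact ⟨p, fun _ _ _ => hp⟩
        · exact ⟨0, fun h1 h2 h3 => absurd ⟨h1, h2, h3⟩ hy⟩
      choose c hc using hP'
      have hfq : ∀ y, P y → y < z → f y ≠ q := fun y hy hyz h =>
        hq z y hz hy hzt hyz hzq (h ▸ (hf y hy hyz).1)
      refine ⟨fun y => if y < z then f y else c y, fun x => if x ≤ z then g x else q,
        fun y hy hyt => ?_, fun x hx hxt => ?_, fun y x hy hx hyt hxt hyx => ?_⟩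
      · dsimp only
        split_ifs with h
        · exact ⟨(hf y hy h).1, hfq y hy h⟩
        · exact hc y hy (by omega) hyt
      · dsimp only
        split_ifs with h
        · exact hg x hx (by omega)
        · exact hQ x hxt (by omega) hx
      · dsimp only
        split_ifs with h h' h'
        · exact hfg y x hy hx h (by omega) hyx
        · exact hfq y hy h
        · omega
        · exact (hc y hy (by omega) hyt).2
    · have hP' : ∀ y, ∃ p, P y → y < t → LP y p ∧ p ≠ q := fun y => by
        by_cases hy : P y ∧ y < t
        · obtain ⟨p, -, hp⟩ := hP y hy.2 hy.1
          exact ⟨p, fun _ _ => hp⟩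
        · exact ⟨0, fun h1 h2 => absurd ⟨h1, h2⟩ hy⟩
      choose c hc using hP'
      exact ⟨c, fun _ => q, hc, fun x hx hxt => hQ x hxt hx, fun y x hy _ hyt _ _ => (hc y hy hyt).2⟩

/-- Excluding `ℓ` excludes nothing, as it is not a page. The page given to `z` conflicts with all
far points below `z`, so it becomes the excluded page. -/
theorem assignable_succ_iff {z ℓ : ℕ} (hz : Q z) (hℓ : ∀ y p, LP y p → p < ℓ) :
    Assignable P Q LP LQ z (z + 1) ℓ ↔ ∃ q, LQ z q ∧ Assignable P Q LP LQ z z q := by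
  constructor
  · rintro ⟨f, g, hf, hg, hfg⟩
    exact ⟨g z, hg z hz (by omega), f, g,
      fun y hy hyz => ⟨(hf y hy hyz).1, hfg y z hy hz hyz (by omega) hyz⟩,
      fun x hx hxz => hg x hx (by omega),
      fun y x hy hx hyz hxz => hfg y x hy hx hyz (by omega)⟩
  · rintro ⟨q, hq, f, g, hf, hg, hfg⟩
    refine ⟨f, fun x => if x = z then q else g x, fun y hy hyz => ⟨(hf y hy hyz).1, fun h => ?_⟩,
      fun x hx hxz => ?_, fun y x hy hx hyz hxz hyx => ?_⟩
    · exact (hℓ y _ (hf y hy hyz).1).ne h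
    · dsimp only
      split_ifs with h
      · exact h ▸ hq
      · exact hg x hx (by omega)
    · dsimp only
      split_ifs with h
      · exact (hf y hy hyz).2
      · exact hfg y x hy hx hyz (by omega) hyx

/-- The recursion computes `Assignable`. -/
theorem assignable_iff_of_recursion {α ℓ : ℕ} {S : ℕ → Prop} (hℓP : ∀ y p, LP y p → p < ℓ)
    (hℓQ : ∀ x p, LQ x p → p < ℓ)
    (hPQ : ∀ p x₀ x y, Q x₀ → Q x → P y → y < x → x < x₀ → x₀ < α → LQ x₀ p → ¬ LQ x p → ¬ LP y p)
    (hS : ∀ z < α, S z ↔ Q z ∧ ∃ q < ℓ, LQ z q ∧ Step ℓ P Q LP LQ S q z) :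
    Assignable P Q LP LQ α α ℓ ↔ Step ℓ P Q LP LQ S ℓ α := by
  have key : ∀ z, Q z → z < α → (S z ↔ Assignable P Q LP LQ z (z + 1) ℓ) := by
    intro z
    induction z using Nat.strong_induction_on with
    | _ z ih =>
      intro hz hzα
      rw [hS z hzα, assignable_succ_iff hz hℓP, and_iff_right hz]
      refine exists_congr fun q => ?_
      rw [← and_assoc, and_iff_right_of_imp (hℓQ z q)]
      refine and_congr_right fun hq => ?_
      refine (assignable_iff_step hℓP (fun x y hx hy hxz hyx hxq => ?_)
        fun z' hz' hlt => ih z' hlt hz' (by omega)).symm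
      exact hPQ q z x y hz hx hy hyx hxz hzα hq hxq
  -- At the top `q = ℓ` lies in no list, so the step just looks for the largest near point below
  -- `α`.
  exact assignable_iff_step hℓP (fun _ y _ _ _ _ _ h => (hℓP y ℓ h).false) key

/-- The assignment problem for the stars of `α` (near) and `β` (far), reduced to the points below
`α`: a single page `q₀` suffices for the near edges to points above `α` that take away a page
which is usable for some far edge. -/
theorem exists_assignment_iff {α β ℓ : ℕ} (hP : ∀ y, P y → y < α) (hQ : ∀ x, Q x → x < β)
    (hQα : ¬ Q α) (hℓP : ∀ y p, LP y p → p < ℓ) (hℓQ : ∀ x p, LQ x p → p < ℓ)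
    (hnested : ∀ p y x x', P y → LP y p → α < x → x < x' → x' < β → LQ x p → LQ x' p) :
    (∃ f g : ℕ → ℕ, (∀ y, P y → LP y (f y)) ∧ (∀ x, Q x → LQ x (g x)) ∧
      ∀ y x, P y → Q x → y < x → f y ≠ g x) ↔
    ∃ q₀ < ℓ + 1, (∀ x < β, α < x → Q x → ∃ p < ℓ, LQ x p ∧ (p = q₀ ∨ ∀ y < α, P y → ¬ LP y p)) ∧
      Assignable P Q (fun y p => LP y p ∧ p ≠ q₀) LQ α α ℓ := by
  classical
  constructor
  · rintro ⟨f, g, hf, hg, hfg⟩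
    have hass : ∀ q₀, (∀ y, P y → f y ≠ q₀) →
        Assignable P Q (fun y p => LP y p ∧ p ≠ q₀) LQ α α ℓ := fun q₀ h =>
      ⟨f, g, fun y hy _ => ⟨⟨hf y hy, h y hy⟩, (hℓP y _ (hf y hy)).ne⟩, fun x hx _ => hg x hx,
        fun y x hy hx _ _ => hfg y x hy hx⟩
    -- `q₀` is the page of the first near point above `α` whose page occurs in some far list. By
    -- `hnested` all later near points can take it too, and it conflicts with every far edge in any
    -- case.
    by_cases h : ∃ x, Q x ∧ α < x ∧ ∃ y, P y ∧ LP y (g x)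
    · obtain ⟨hz, hzα, y₀, hy₀, hy₀z⟩ := Nat.find_spec h
      set z := Nat.find h with hzdef
      refine ⟨g z, (hℓP _ _ hy₀z).trans (Nat.lt_succ_self ℓ), fun x _ hxα hx => ?_,
        hass _ fun y hy => hfg y z hy hz ((hP y hy).trans hzα)⟩
      by_cases hc : ∃ y, P y ∧ LP y (g x)
      · refine ⟨g z, hℓP _ _ hy₀z, ?_, .inl rfl⟩
        rcases (Nat.find_min' h ⟨hx, hxα, hc⟩).lt_or_eq with hlt | heq
        · exact hnested _ y₀ z x hy₀ hy₀z hzα hlt (hQ x hx) (hg z hz)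
        · rw [← hzdef] at heq
          exact heq ▸ hg z hz
      · push Not at hc
        exact ⟨g x, hℓQ _ _ (hg x hx), hg x hx, .inr fun y _ => hc y⟩
    · push Not at h
      -- The value `ℓ` means that no page is withdrawn from the far edges; hence the range `ℓ + 1`
      -- for `q₀`.
      exact ⟨ℓ, Nat.lt_succ_self ℓ, fun x _ hxα hx =>
        ⟨g x, hℓQ _ _ (hg x hx), hg x hx, .inr fun y _ => h x hx hxα y⟩,
        hass _ fun y hy => (hℓP y _ (hf y hy)).ne⟩
  · rintro ⟨q₀, -, h₁, f, g, hf, hg, hfg⟩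
    have h₁' : ∀ x, ∃ p, Q x → α < x → LQ x p ∧ (p = q₀ ∨ ∀ y < α, P y → ¬ LP y p) := fun x => by
      by_cases hx : Q x ∧ α < x
      · obtain ⟨p, -, hp⟩ := h₁ x (hQ x hx.1) hx.2 hx.1
        exact ⟨p, fun _ _ => hp⟩
      · exact ⟨0, fun h1 h2 => absurd ⟨h1, h2⟩ hx⟩
    choose c hc using h₁'
    have hlt : ∀ x, Q x → ¬ x < α → α < x := fun x hx h =>
      lt_of_le_of_ne (not_lt.mp h) fun h' => hQα (h' ▸ hx)
    refine ⟨f, fun x => if x < α then g x else c x, fun y hy => (hf y hy (hP y hy)).1.1,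
      fun x hx => ?_, fun y x hy hx hyx => ?_⟩
    · dsimp only
      split_ifs with h
      · exact hg x hx h
      · exact (hc x hx (hlt x hx h)).1
    · dsimp only
      split_ifs with h
      · exact hfg y x hy hx (hP y hy) h hyx
      · rcases (hc x hx (hlt x hx h)).2 with h' | h'
        · rw [h']
          exact (hf y hy (hP y hy)).1.2
        · intro h''
          exact h' y (hP y hy) hy (h'' ▸ (hf y hy (hP y hy)).1.1)

/-- The criterion for the existence of an assignment of pages to the two stars. -/
def Criterion (ℓ : ℕ) (P Q : ℕ → Prop) (LP LQ : ℕ → ℕ → Prop) (α β : ℕ) : Prop :=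
  ∃ q₀ < ℓ + 1,
    (∀ x < β, α < x → Q x → ∃ p < ℓ, LQ x p ∧ (p = q₀ ∨ ∀ y < α, P y → ¬ LP y p)) ∧
    Step ℓ P Q (fun y p => LP y p ∧ p ≠ q₀) LQ (fun z => (RAM.tabulate (fun t l =>
      Q t ∧ ∃ q < ℓ, LQ t q ∧
        Step ℓ P Q (fun y p => LP y p ∧ p ≠ q₀) LQ (fun z => l.getD z False) q t) α).getD z False)
      ℓ α

/-- Deleting `q₀` from the far lists preserves `hPQ`, and a table of length `t` agrees below `t`
with the full one, so the table satisfies the recursion. -/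
theorem criterion_iff {α β ℓ : ℕ} (hP : ∀ y, P y → y < α) (hQ : ∀ x, Q x → x < β)
    (hQα : ¬ Q α) (hℓP : ∀ y p, LP y p → p < ℓ) (hℓQ : ∀ x p, LQ x p → p < ℓ)
    (hnested : ∀ p y x x', P y → LP y p → α < x → x < x' → x' < β → LQ x p → LQ x' p)
    (hPQ : ∀ p x₀ x y, y < x → x < x₀ → x₀ < α → LQ x₀ p → ¬ LQ x p → P y → ¬ LP y p) :
    Criterion ℓ P Q LP LQ α β ↔
      ∃ f g : ℕ → ℕ, (∀ y, P y → LP y (f y)) ∧ (∀ x, Q x → LQ x (g x)) ∧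
        ∀ y x, P y → Q x → y < x → f y ≠ g x := by
  rw [exists_assignment_iff hP hQ hQα hℓP hℓQ hnested]
  refine exists_congr fun q₀ => and_congr_right fun _ => and_congr_right fun _ => ?_
  refine (assignable_iff_of_recursion (fun y p h => hℓP y p h.1) hℓQ ?_ fun z hz => ?_).symm
  · exact fun p x₀ x y _ _ hy h1 h2 h3 h4 h5 h6 => hPQ p x₀ x y h1 h2 h3 h4 h5 hy h6.1
  · rw [RAM.getD_tabulate, and_iff_right hz]
    refine and_congr_right fun _ => exists_congr fun q => and_congr_right fun _ =>
      and_congr_right fun _ => Step.congr fun z' hz' => ?_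
    rw [RAM.getD_tabulate, RAM.getD_tabulate, and_iff_right hz', and_iff_right (hz'.trans hz)]

end Stars

/-! ### Nesting in terms of positions. -/

/-- `c` lies strictly between `a` and `b`. -/
def Btw (a b c : ℕ) : Prop := (a < c ∧ c < b) ∨ (b < c ∧ c < a)

/-- One of the edges `ab` and `cd` between positions nests the other one. -/
def Nest (a b c d : ℕ) : Prop := (Btw a b c ∧ Btw a b d) ∨ (Btw c d a ∧ Btw c d b)

/-- An edge between the positions `a` and `b` can be put on page `p` without a nesting relation to
an old edge; the page of the old edge `cd` is `pg c d - 1`. -/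
def Allowed (n : ℕ) (pg : ℕ → ℕ → ℕ) (pos : ℕ → ℕ) (a b p : ℕ) : Prop :=
  ∀ c < n, ∀ d < n, pg c d = p + 1 → ¬ Nest a b (pos c) (pos d)

/-- The criterion for the stars of two new vertices: `far` at position `β`, whose old neighbours
below `α` are considered, and `near` at position `α`, with its old neighbours below `β`. -/
def StarCriterion (n ℓ : ℕ) (sp : ℕ → ℕ) (adj : ℕ → ℕ → Prop) (pg : ℕ → ℕ → ℕ) (pos : ℕ → ℕ)
    (far near α β : ℕ) : Prop :=
  Criterion ℓ (fun z => z < α ∧ ∃ y < n, 0 < sp y ∧ adj far y ∧ pos y = z)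
    (fun z => z < β ∧ ∃ x < n, 0 < sp x ∧ adj near x ∧ pos x = z)
    (fun z p => p < ℓ ∧ Allowed n pg pos β z p) (fun z p => p < ℓ ∧ Allowed n pg pos α z p) α β

theorem starCriterion_iff {n ℓ : ℕ} {sp : ℕ → ℕ} {adj : ℕ → ℕ → Prop} {pg : ℕ → ℕ → ℕ}
    {pos : ℕ → ℕ} {far near α β : ℕ} (hαβ : α < β) (hα : ∀ x < n, pos x ≠ α) :
    StarCriterion n ℓ sp adj pg pos far near α β ↔ ∃ f g : ℕ → ℕ,
      (∀ y < n, 0 < sp y → adj far y → pos y < α →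
        f (pos y) < ℓ ∧ Allowed n pg pos β (pos y) (f (pos y))) ∧
      (∀ x < n, 0 < sp x → adj near x → pos x < β →
        g (pos x) < ℓ ∧ Allowed n pg pos α (pos x) (g (pos x))) ∧
      ∀ y < n, 0 < sp y → adj far y → pos y < α → ∀ x < n, 0 < sp x → adj near x → pos x < β →
        pos y < pos x → f (pos y) ≠ g (pos x) := by
  rw [StarCriterion, criterion_iff (fun y hy => hy.1) (fun x hx => hx.1)
    (fun ⟨_, x, hxn, _, _, hx⟩ => hα x hxn hx) (fun _ _ h => h.1) (fun _ _ h => h.1)]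
  · refine exists_congr fun f => exists_congr fun g => and_congr ?_ (and_congr ?_ ?_)
    · exact ⟨fun h y h1 h2 h3 h4 => h _ ⟨h4, y, h1, h2, h3, rfl⟩,
        fun h z ⟨h1, y, h2, h3, h4, h5⟩ => h5 ▸ h y h2 h3 h4 (h5 ▸ h1)⟩
    · exact ⟨fun h y h1 h2 h3 h4 => h _ ⟨h4, y, h1, h2, h3, rfl⟩,
        fun h z ⟨h1, y, h2, h3, h4, h5⟩ => h5 ▸ h y h2 h3 h4 (h5 ▸ h1)⟩
    · constructor
      · exact fun h y h1 h2 h3 h4 x h5 h6 h7 h8 h9 =>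
          h _ _ ⟨h4, y, h1, h2, h3, rfl⟩ ⟨h8, x, h5, h6, h7, rfl⟩ h9
      · rintro h _ _ ⟨h4, y, h1, h2, h3, rfl⟩ ⟨h8, x, h5, h6, h7, rfl⟩ h9
        exact h y h1 h2 h3 h4 x h5 h6 h7 h8 h9
  -- An old edge around `αx'` would also be around `αx`; an old edge inside `αx'` lies inside `βy`,
  -- because `y < α` and `x' < β`. Both are excluded.
  · rintro p y x x' ⟨hy, -⟩ ⟨-, hP⟩ h1 h2 h3 ⟨hp, hQ⟩
    refine ⟨hp, fun c hc d hd hcd hn => ?_⟩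
    have hP' := hP c hc d hd hcd
    have hQ' := hQ c hc d hd hcd
    simp only [Nest, Btw] at hn hP' hQ'
    omega
  -- An old edge around `αx` would be around `αx₀`, so a blocking edge lies between `x` and `α`,
  -- hence inside `βy`.
  · rintro p x₀ x y h1 h2 h3 ⟨hp, hx₀⟩ hx - ⟨-, hP⟩
    refine hx ⟨hp, fun c hc d hd hcd hn => ?_⟩
    have hP' := hP c hc d hd hcd
    have hx₀' := hx₀ c hc d hd hcd
    simp only [Nest, Btw] at hn hP' hx₀'
    omega

theorem allowed_mirror {n : ℕ} {pg : ℕ → ℕ → ℕ} {pos : ℕ → ℕ} {C a b p : ℕ}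
    (hC : ∀ x < n, pos x ≤ C) (ha : a ≤ C) (hb : b ≤ C) :
    Allowed n pg (fun x => C - pos x) (C - a) (C - b) p ↔ Allowed n pg pos a b p := by
  refine forall₂_congr fun c hc => forall₂_congr fun d hd => imp_congr_right fun _ => not_congr ?_
  have := hC c hc
  have := hC d hd
  simp only [Nest, Btw]
  omega

/-- The two mirror-image criteria together decide whether pages can be assigned to all edges
between one of two new vertices, at positions `α < β`, and the old vertices. -/
theorem starCriterion_both {n ℓ : ℕ} {sp : ℕ → ℕ} {adj : ℕ → ℕ → Prop} {pg : ℕ → ℕ → ℕ}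
    {pos : ℕ → ℕ} {u v α β C : ℕ} (hαβ : α < β) (hα : ∀ x < n, pos x ≠ α) (hβ : ∀ x < n, pos x ≠ β)
    (hβC : β < C) (hC : ∀ x < n, pos x < C) :
    (StarCriterion n ℓ sp adj pg pos v u α β ∧
      StarCriterion n ℓ sp adj pg (fun x => C - pos x) u v (C - β) (C - α)) ↔
    ∃ f g : ℕ → ℕ,
      (∀ x < n, 0 < sp x → adj u x → f (pos x) < ℓ ∧ Allowed n pg pos α (pos x) (f (pos x))) ∧
      (∀ y < n, 0 < sp y → adj v y → g (pos y) < ℓ ∧ Allowed n pg pos β (pos y) (g (pos y))) ∧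
      ∀ x < n, 0 < sp x → adj u x → ∀ y < n, 0 < sp y → adj v y →
        Nest α (pos x) β (pos y) → f (pos x) ≠ g (pos y) := by
  have hC' : ∀ x < n, pos x ≤ C := fun x hx => (hC x hx).le
  have hmir : ∀ x < n, C - (C - pos x) = pos x := fun x hx => by have := hC x hx; omega
  have hβ' : ∀ x < n, C - pos x ≠ C - β := fun x hx => by
    have := hC x hx; have := hβ x hx; omega
  constructor
  · rintro ⟨hB, hA⟩
    rw [starCriterion_iff hαβ hα] at hB
    obtain ⟨f₁, g₁, h1, h2, h3⟩ := hB
    rw [starCriterion_iff (by omega) hβ'] at hA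
    obtain ⟨f₂, g₂, k1, k2, k3⟩ := hA
    -- Every edge belongs to exactly one of the two subproblems. Edges from different subproblems
    -- never nest, since `αx` can only surround `β` if `x > β`, and `βy` can only surround `α` if `y
    -- < α`.
    refine ⟨fun z => if z < β then g₁ z else f₂ (C - z),
      fun z => if z < α then f₁ z else g₂ (C - z), fun x hx hx0 hux => ?_,
      fun y hy hy0 hvy => ?_, fun x hx hx0 hux y hy hy0 hvy hn => ?_⟩
    · dsimp only
      split_ifs with h
      · exact h2 x hx hx0 hux h
      · have := k1 x hx hx0 hux (by have := hβ x hx; have := hC x hx; omega)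
        rwa [allowed_mirror hC' (by omega) (hC' x hx)] at this
    · dsimp only
      split_ifs with h
      · exact h1 y hy hy0 hvy h
      · have := k2 y hy hy0 hvy (by have := hα y hy; have := hC y hy; omega)
        rwa [allowed_mirror hC' (by omega) (hC' y hy)] at this
    · have := hα x hx; have := hα y hy; have := hβ x hx; have := hβ y hy
      have := hC x hx; have := hC y hy
      simp only [Nest, Btw] at hn
      dsimp only
      split_ifs with h h' h'
      · exact (h3 y hy hy0 hvy h' x hx hx0 hux h (by omega)).symm
      · omega
      · omega
      · exact k3 x hx hx0 hux (by omega) y hy hy0 hvy (by omega) (by omega)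
  · rintro ⟨f, g, hf, hg, hfg⟩
    rw [starCriterion_iff hαβ hα, starCriterion_iff (by omega) hβ']
    refine ⟨⟨g, f, fun y hy hy0 hvy _ => hg y hy hy0 hvy, fun x hx hx0 hux _ => hf x hx hx0 hux,
      fun y hy hy0 hvy hyα x hx hx0 hux hxβ hyx => (hfg x hx hx0 hux y hy hy0 hvy ?_).symm⟩, ?_⟩
    · have := hα x hx
      simp only [Nest, Btw]
      omega
    · refine ⟨fun z => f (C - z), fun z => g (C - z), fun x hx hx0 hux _ => ?_,
        fun y hy hy0 hvy _ => ?_, fun x hx hx0 hux hxβ y hy hy0 hvy hyα hxy => ?_⟩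
      · dsimp only
        rw [hmir x hx, allowed_mirror hC' (by omega) (hC' x hx)]
        exact hf x hx hx0 hux
      · dsimp only
        rw [hmir y hy, allowed_mirror hC' (by omega) (hC' y hy)]
        exact hg y hy hy0 hvy
      · dsimp only
        rw [hmir x hx, hmir y hy]
        refine hfg x hx hx0 hux y hy hy0 hvy ?_
        have := hC x hx; have := hC y hy
        simp only [Nest, Btw]
        omega

/-! ### The criterion as a formula -/

section Criterion

variable (w : ℕ → ℕ)

/-- Entry `x` of the list of spine entries in the input `w`. -/
def spW (x : ℕ) : ℕ := w (2 + x)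

/-- Entry of the adjacency matrix in the input `w`. -/
def adjW (x y : ℕ) : Prop := w (2 + w 1 + (x * w 1 + y)) = 1

/-- Entry of the page matrix in the input `w`. -/
def pgW (x y : ℕ) : ℕ := w (2 + w 1 + w 1 * w 1 + (x * w 1 + y))

/-- The position of an old vertex, with room for two new vertices after each of them. -/
def posW (x : ℕ) : ℕ := 3 * spW w x

/-- The positions in the opposite direction. -/
def mirW (x : ℕ) : ℕ := 3 * w 1 + 3 - posW w x

/-- The criterion for the existence of a layout in which the new vertices `u` and `v` stand after
the old vertices number `i` and `j`, respectively. -/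
def PlacementCriterion (u v i j : ℕ) : Prop :=
  (adjW w u v → ∃ p < w 0, Allowed (w 1) (pgW w) (posW w) (3 * i + 1) (3 * j + 2) p) ∧
  StarCriterion (w 1) (w 0) (spW w) (adjW w) (pgW w) (posW w) v u (3 * i + 1) (3 * j + 2) ∧
  StarCriterion (w 1) (w 0) (spW w) (adjW w) (pgW w) (mirW w) u v
    (3 * w 1 + 3 - (3 * j + 2)) (3 * w 1 + 3 - (3 * i + 1))

def InputCriterion : Prop :=
  ∃ u < w 1, ∃ v < w 1, u ≠ v ∧ spW w u = 0 ∧ spW w v = 0 ∧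
    ∃ i < w 1, ∃ j < w 1, i ≤ j ∧ PlacementCriterion w u v i j

end Criterion

/-! ### Syntax of the criterion; variables are numbered by binding depth, so terms need no shifting
under binders. -/

open RAM Term Formula

def ellT : Term := inp (const 0)

def numT : Term := inp (const 1)

def spT (x : Term) : Term := inp (add (const 2) x)

def adjF (x y : Term) : Formula :=
  eq (inp (add (add (const 2) numT) (add (mul x numT) y))) (const 1)

def pgT (x y : Term) : Term :=
  inp (add (add (add (const 2) numT) (mul numT numT)) (add (mul x numT) y))

def posT (x : Term) : Term := mul (const 3) (spT x)

def mirT (x : Term) : Term := sub (add (mul (const 3) numT) (const 3)) (posT x)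

def btwF (a b c : Term) : Formula :=
  or (and (lt a c) (lt c b)) (and (lt b c) (lt c a))

def nestF (a b c d : Term) : Formula :=
  or (and (btwF a b c) (btwF a b d)) (and (btwF c d a) (btwF c d b))

/-- `Allowed`, at depth `k`. -/
def allowedF (k : ℕ) (pos : Term → Term) (a b p : Term) : Formula :=
  all numT (all numT (imp (eq (pgT (var k) (var (k + 1))) (add p (const 1)))
    (not (nestF a b (pos (var k)) (pos (var (k + 1)))))))

/-- `Step`, at depth `k`. -/
def stepF (P Q : ℕ → Term → Formula) (LP LQ : ℕ → Term → Term → Formula) (S : Term → Formula)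
    (k : ℕ) (q t : Term) : Formula :=
  or (ex t (and (Q (k + 1) (var k)) (and (not (LQ (k + 1) (var k) q))
      (and (all t (imp (lt (var k) (var (k + 1)))
        (imp (Q (k + 2) (var (k + 1))) (LQ (k + 2) (var (k + 1)) q))))
      (and (all t (imp (le (var k) (var (k + 1))) (imp (P (k + 2) (var (k + 1)))
        (ex ellT (and (LP (k + 3) (var (k + 1)) (var (k + 2))) (not (eq (var (k + 2)) q)))))))
      (S (var k)))))))
    (and (all t (imp (Q (k + 1) (var k)) (LQ (k + 1) (var k) q)))
      (all t (imp (P (k + 1) (var k))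
        (ex ellT (and (LP (k + 2) (var k) (var (k + 1))) (not (eq (var (k + 1)) q)))))))

/-- `Criterion`, at depth `k`. -/
def criterionF (P Q : ℕ → Term → Formula) (LP LQ : ℕ → Term → Term → Formula) (k : ℕ)
    (α β : Term) : Formula :=
  let LP' : ℕ → Term → Term → Formula := fun m y p => and (LP m y p) (not (eq p (var k)))
  -- Level `k + 1` is the table variable both in the table's body, where it holds the earlier
  -- entries, and in the final formula, where it is complete.
  let S : Term → Formula := fun z => tab (k + 1) z
  ex (add ellT (const 1)) (and
    (all β (imp (lt α (var (k + 1))) (imp (Q (k + 2) (var (k + 1)))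
      (ex ellT (and (LQ (k + 3) (var (k + 1)) (var (k + 2))) (or (eq (var (k + 2)) (var k))
        (all α (imp (P (k + 4) (var (k + 3))) (not (LP (k + 4) (var (k + 3)) (var (k + 2))))))))))))
    (letTab α
      (and (Q (k + 2) (var (k + 1))) (ex ellT (and (LQ (k + 3) (var (k + 1)) (var (k + 2)))
        (stepF P Q LP' LQ S (k + 3) (var (k + 2)) (var (k + 1))))))
      (stepF P Q LP' LQ S (k + 2) ellT α)))

/-- `StarCriterion`, at depth `k`. -/
def starF (pos : Term → Term) (k : ℕ) (far near α β : Term) : Formula :=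
  let nbr : Term → Term → ℕ → Term → Formula := fun c b m z =>
    and (lt z b) (ex numT (and (lt (const 0) (spT (var m)))
      (and (adjF c (var m)) (eq (pos (var m)) z))))
  let list : Term → ℕ → Term → Term → Formula := fun a m z p =>
    and (lt p ellT) (allowedF m pos a z p)
  criterionF (nbr far α) (nbr near β) (list β) (list α) k α β

def placementF : Formula :=
  let α : Term := add (mul (const 3) (var 2)) (const 1)
  let β : Term := add (mul (const 3) (var 3)) (const 2)
  let C : Term := add (mul (const 3) numT) (const 3)
  and (imp (adjF (var 0) (var 1)) (ex ellT (allowedF 5 posT α β (var 4))))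
    (and (starF posT 4 (var 1) (var 0) α β) (starF mirT 4 (var 0) (var 1) (sub C β) (sub C α)))

def inputF : Formula :=
  ex numT (ex numT (and (not (eq (var 0) (var 1))) (and (eq (spT (var 0)) (const 0))
    (and (eq (spT (var 1)) (const 0)) (ex numT (ex numT (and (le (var 2) (var 3)) placementF)))))))

theorem holds_placementF (w : ℕ → ℕ) (u v i j : ℕ) :
    placementF.holds w [(u, []), (v, []), (i, []), (j, [])] ↔ PlacementCriterion w u v i j := by
  simp only [placementF, starF, criterionF, stepF, allowedF, nestF, btwF, mirT, posT, pgT, adjF,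
    spT, numT, ellT, holds, eval, Env.val, Env.table, List.cons_append, List.nil_append,
    List.getD_cons_succ, List.getD_cons_zero, PlacementCriterion, StarCriterion, Criterion, Step,
    Allowed, Nest, Btw, mirW, posW, spW, adjW, pgW, Nat.reduceAdd]

theorem holds_inputF (w : ℕ → ℕ) : inputF.holds w [] ↔ InputCriterion w := by
  simp only [inputF, holds, List.nil_append, List.cons_append, holds_placementF]
  rfl

/-! ### Reading the encoding -/

namespace Instance

theorem length_flatten_ofFn {m n : ℕ} (M : Fin m → Fin n → ℕ) :
    (List.ofFn fun x => List.ofFn fun y => M x y).flatten.length = m * n := by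
  simp [List.length_flatten, List.map_ofFn, Function.comp_def]

theorem getD_flatten_ofFn {m n : ℕ} (M : Fin m → Fin n → ℕ) (x : Fin m) (y : Fin n) :
    (List.ofFn fun x => List.ofFn fun y => M x y).flatten.getD (x * n + y) 0 = M x y := by
  induction m with
  | zero => exact x.elim0
  | succ m ih =>
    rw [List.ofFn_succ, List.flatten_cons]
    refine Fin.cases ?_ (fun x => ?_) x
    · rw [List.getD_append _ _ _ _ (by simp)]
      simp
    · have h : ((x.succ : Fin (m + 1)) : ℕ) * n + y = n + (x * n + y) := by
        rw [Fin.val_succ]; ring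
      rw [List.getD_append_right _ _ _ _ (by rw [h, List.length_ofFn]; omega), h, List.length_ofFn,
        Nat.add_sub_cancel_left]
      exact ih (fun x => M x.succ) x

theorem length_matrixEntries {n : ℕ} (M : Fin n → Fin n → ℕ) :
    (matrixEntries M).length = n * n :=
  length_flatten_ofFn M

/-- The input as a function. -/
noncomputable def input (I : Instance) (j : ℕ) : ℕ := I.encode.getD j 0

variable (I : Instance)

theorem input_zero : I.input 0 = I.ℓ := rfl

theorem input_one : I.input 1 = I.n := rfl

theorem spW_input (x : Fin I.n) : spW I.input x = I.spineEntry x := by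
  rw [spW, input, encode, List.append_assoc, List.append_assoc,
    List.getD_append_right _ _ _ _ (by simp), List.getD_append _ _ _ _ (by simp)]
  simp

theorem adjW_input (x y : Fin I.n) : adjW I.input x y ↔ I.G.Adj x y := by
  have hlt : (x : ℕ) * I.n + y < I.n * I.n := by
    have := Nat.mul_le_mul_right I.n (Nat.succ_le_of_lt x.2)
    have := y.2
    rw [Nat.succ_mul] at *
    omega
  rw [adjW, input_one, input, encode, List.append_assoc, List.append_assoc,
    List.getD_append_right _ _ _ _ (by simp; omega), List.getD_append_right _ _ _ _ (by simp; omega),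
    List.getD_append _ _ _ _ (by simp [length_matrixEntries]; omega)]
  have : 2 + I.n + (↑x * I.n + ↑y) - [I.ℓ, I.n].length - (List.ofFn I.spineEntry).length
      = x * I.n + y := by simp; omega
  rw [this, matrixEntries, getD_flatten_ofFn, adjEntry]
  split_ifs <;> simp_all

theorem pgW_input (x y : Fin I.n) : pgW I.input x y = I.pageEntry x y := by
  rw [pgW, input_one, input, encode, List.append_assoc, List.append_assoc,
    List.getD_append_right _ _ _ _ (by simp; omega), List.getD_append_right _ _ _ _ (by simp; omega),
    List.getD_append_right _ _ _ _ (by simp [length_matrixEntries]; omega)]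
  have : 2 + I.n + I.n * I.n + (↑x * I.n + ↑y) - [I.ℓ, I.n].length
      - (List.ofFn I.spineEntry).length - (matrixEntries I.adjEntry).length = x * I.n + y := by
    simp [length_matrixEntries]; omega
  rw [this, matrixEntries, getD_flatten_ofFn]

theorem spineEntry_le (x : Fin I.n) : I.spineEntry x ≤ I.n := by
  rw [spineEntry]
  split_ifs with h
  · have := I.layoutH.strictTotal
    have h1 : {y : I.H.verts | I.layoutH.spine y ⟨x, h⟩}.ncard < (Set.univ : Set I.H.verts).ncard :=
      by
      refine Set.ncard_lt_ncard ⟨Set.subset_univ _, fun hs => ?_⟩ (Set.toFinite _)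
      exact irrefl_of I.layoutH.spine _ (hs (Set.mem_univ (⟨x, h⟩ : I.H.verts)))
    have h2 : (Set.univ : Set I.H.verts).ncard ≤ I.n := by
      rw [Set.ncard_univ]
      simpa using Nat.card_le_card_of_injective (Subtype.val : I.H.verts → Fin I.n)
        Subtype.val_injective
    omega
  · exact Nat.zero_le _

theorem encode_le_size {a : ℕ} (ha : a ∈ I.encode) : a ≤ I.size := by
  -- This makes the adjacency entries `1` at most the size.
  have h1 := I.one_le_ℓ
  simp only [encode, matrixEntries, List.mem_append, List.mem_cons, List.not_mem_nil, or_false,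
    List.mem_ofFn, List.mem_flatten] at ha
  rw [size]
  rcases ha with (((rfl | rfl) | ⟨x, rfl⟩) | ⟨_, ⟨x, rfl⟩, ha⟩) | ⟨_, ⟨x, rfl⟩, ha⟩
  · omega
  · omega
  · have := I.spineEntry_le x
    omega
  · obtain ⟨y, rfl⟩ := List.mem_ofFn.mp ha
    rw [adjEntry]
    split_ifs <;> omega
  · obtain ⟨y, rfl⟩ := List.mem_ofFn.mp ha
    rw [pageEntry]
    split_ifs with h
    · have := (I.layoutH.page (edgeOf I.H.coe (x := ⟨x, I.H.edge_vert h⟩)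
        (y := ⟨y, I.H.edge_vert h.symm⟩) h)).2
      omega
    · omega

end Instance

/-! ### Layouts as positions and page numbers -/

/-- `c ≠ d` is needed because `Btw` does not separate the inner endpoints, whereas `Nests` does. -/
theorem nests_iff {V : Type*} {lt : V → V → Prop} {pos : V → ℕ} (hpos : Function.Injective pos)
    (hlt : ∀ x y, lt x y ↔ pos x < pos y) {a b c d : V} (hcd : c ≠ d) :
    Nests lt s(a, b) s(c, d) ↔
      Btw (pos a) (pos b) (pos c) ∧ Btw (pos a) (pos b) (pos d) := by
  have hne : pos c ≠ pos d := hpos.ne hcd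
  simp only [Nests, hlt, Btw]
  constructor
  · rintro ⟨u₁, v₁, u₂, v₂, h1, h2, h3, h4, h5⟩
    rcases Sym2.eq_iff.mp h1 with ⟨rfl, rfl⟩ | ⟨rfl, rfl⟩ <;>
      rcases Sym2.eq_iff.mp h2 with ⟨rfl, rfl⟩ | ⟨rfl, rfl⟩ <;> omega
  · rintro ⟨h1, h2⟩
    rcases hne.lt_or_gt with h | h <;> rcases h1 with h1 | h1
    · exact ⟨a, b, c, d, rfl, rfl, by omega, by omega, by omega⟩
    · exact ⟨b, a, c, d, Sym2.eq_swap, rfl, by omega, by omega, by omega⟩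
    · exact ⟨a, b, d, c, rfl, Sym2.eq_swap, by omega, by omega, by omega⟩
    · exact ⟨b, a, d, c, Sym2.eq_swap, Sym2.eq_swap, by omega, by omega, by omega⟩

theorem lt_iff_ncard_lt {V : Type*} [Finite V] {lt : V → V → Prop} (h : IsStrictTotalOrder V lt)
    (x y : V) : lt x y ↔ {z | lt z x}.ncard < {z | lt z y}.ncard := by
  have hlt : ∀ x y, lt x y → {z | lt z x}.ncard < {z | lt z y}.ncard := fun x y hxy =>
    Set.ncard_lt_ncard ⟨fun z hz => trans_of lt hz hxy, fun hs => irrefl_of lt x (hs hxy)⟩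
      (Set.toFinite _)
  refine ⟨hlt x y, fun hxy => ?_⟩
  rcases trichotomous_of lt x y with h | rfl | h
  · exact h
  · exact absurd hxy (lt_irrefl _)
  · exact absurd (hlt y x h) hxy.not_gt

theorem injective_of_lt_iff {V : Type*} {lt : V → V → Prop} (h : IsStrictTotalOrder V lt)
    {pos : V → ℕ} (hpos : ∀ x y, lt x y ↔ pos x < pos y) : Function.Injective pos := by
  intro x y hxy
  rcases trichotomous_of lt x y with h | h | h
  · exact absurd hxy ((hpos x y).1 h).ne
  · exact h
  · exact absurd hxy ((hpos y x).1 h).ne'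

namespace Instance

variable (I : Instance)

/-- Positions of the vertices and pages of the edges that describe an extension of the given
layout. -/
structure IsExtension (pos : Fin I.n → ℕ) (col : Fin I.n → Fin I.n → ℕ) : Prop where
  injective : Function.Injective pos
  spine : ∀ x y : I.H.verts, I.layoutH.spine x y ↔ pos x < pos y
  symm : ∀ x y, col x y = col y x
  lt : ∀ x y, I.G.Adj x y → col x y < I.ℓ
  page : ∀ x y, I.H.Adj x y → I.pageEntry x y = col x y + 1
  not_nest : ∀ a b c d, I.G.Adj a b → I.G.Adj c d → col a b = col c d →
    ¬ Nest (pos a) (pos b) (pos c) (pos d)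

/-- This trades orders and edge-indexed pages for numerical functions. Positions count predecessors;
the page `0` of a non-edge carries no meaning. -/
theorem isPositive_iff : I.IsPositive ↔ ∃ pos col, I.IsExtension pos col := by
  classical
  constructor
  · rintro ⟨L, hL₁, hL₂⟩
    have hpos := lt_iff_ncard_lt L.strictTotal
    have hinj := injective_of_lt_iff L.strictTotal hpos
    refine ⟨fun x => {z | L.spine z x}.ncard, fun x y => if h : I.G.Adj x y then L.page (edgeOf I.G h) else 0, hinj,
      fun x y => (hL₁ x y).trans (hpos x y), fun x y => ?_, fun x y h => ?_, fun x y h => ?_,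
      fun a b c d hab hcd h => ?_⟩
    · by_cases h : I.G.Adj x y
      · rw [dif_pos h, dif_pos h.symm]
        congr 2
        exact Subtype.ext Sym2.eq_swap
      · rw [dif_neg h, dif_neg fun h' => h h'.symm]
    · rw [dif_pos h]
      exact Fin.is_lt _
    · rw [pageEntry, dif_pos h, dif_pos (I.H.adj_sub h)]
      rw [← hL₂ ⟨x, I.H.edge_vert h⟩ ⟨y, I.H.edge_vert h.symm⟩ h]
    · rw [dif_pos hab, dif_pos hcd] at h
      rw [Nest, ← nests_iff hinj hpos hcd.ne, ← nests_iff hinj hpos hab.ne]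
      exact not_or_intro (L.not_nests _ _ (Fin.ext h)) (L.not_nests _ _ (Fin.ext h.symm))
  · rintro ⟨pos, col, hinj, hspine, hsymm, hlt, hpage, hnest⟩
    have hlt' : ∀ e : I.G.edgeSet, Sym2.lift ⟨col, hsymm⟩ (e : Sym2 (Fin I.n)) < I.ℓ := by
      rintro ⟨e, he⟩
      induction e with
      | _ x y => exact hlt x y he
    let emb : (fun x y => pos x < pos y) ↪r ((· < ·) : ℕ → ℕ → Prop) := ⟨⟨pos, hinj⟩, Iff.rfl⟩
    refine ⟨⟨fun x y => pos x < pos y, emb.isStrictTotalOrder,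
      fun e => ⟨Sym2.lift ⟨col, hsymm⟩ (e : Sym2 (Fin I.n)), hlt' e⟩, ?_⟩,
      hspine, fun x y h => ?_⟩
    · rintro ⟨e, he⟩ ⟨f, hf⟩ hef
      induction e with
      | _ a b =>
        induction f with
        | _ c d =>
          rw [nests_iff hinj (fun _ _ => Iff.rfl) (SimpleGraph.Adj.ne hf)]
          exact fun h => hnest a b c d he hf (congrArg Fin.val hef) (.inl h)
    · have := hpage x y h
      rw [pageEntry, dif_pos (show I.H.Adj x y from h)] at this
      refine Fin.ext ?_
      simpa [edgeOf] using (Nat.succ_injective this).symm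

end Instance

theorem Nest.swap_left {a b c d : ℕ} (h : Nest a b c d) : Nest b a c d := by
  simp only [Nest, Btw] at h ⊢; omega

theorem Nest.comm {a b c d : ℕ} (h : Nest a b c d) : Nest c d a b := h.symm

namespace Instance

variable {I : Instance}

/-- Only the order of the positions enters, so they can be normalized to those of `place`. -/
theorem IsExtension.congr {pos pos' : Fin I.n → ℕ} {col : Fin I.n → Fin I.n → ℕ}
    (h : I.IsExtension pos col) (hpos : ∀ x y, pos x < pos y ↔ pos' x < pos' y) :
    I.IsExtension pos' col where
  injective x y hxy := by
    rcases lt_trichotomy (pos x) (pos y) with h' | h' | h'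
    · exact absurd hxy ((hpos x y).1 h').ne
    · exact h.injective h'
    · exact absurd hxy ((hpos y x).1 h').ne'
  spine x y := (h.spine x y).trans (hpos x y)
  symm := h.symm
  lt := h.lt
  page := h.page
  not_nest a b c d hab hcd hc hn := h.not_nest a b c d hab hcd hc <| by
    simpa only [Nest, Btw, hpos] using hn

theorem spineEntry_eq_zero {x : Fin I.n} : I.spineEntry x = 0 ↔ x ∉ I.H.verts := by
  rw [spineEntry]
  split_ifs with h <;> simp [h]

theorem spine_iff_spineEntry (x y : I.H.verts) :
    I.layoutH.spine x y ↔ I.spineEntry x < I.spineEntry y := by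
  rw [spineEntry, spineEntry, dif_pos x.2, dif_pos y.2, Nat.succ_lt_succ_iff]
  exact lt_iff_ncard_lt I.layoutH.strictTotal x y

theorem spineEntry_injOn {x y : Fin I.n} (hx : x ∈ I.H.verts) (hy : y ∈ I.H.verts)
    (h : I.spineEntry x = I.spineEntry y) : x = y :=
  congrArg Subtype.val (injective_of_lt_iff I.layoutH.strictTotal spine_iff_spineEntry
    (a₁ := ⟨x, hx⟩) (a₂ := ⟨y, hy⟩) h)

theorem pageEntry_comm (x y : Fin I.n) : I.pageEntry x y = I.pageEntry y x := by
  by_cases h : I.H.Adj x y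
  · rw [pageEntry, pageEntry, dif_pos h, dif_pos h.symm]
    congr 3
    exact Subtype.ext Sym2.eq_swap
  · rw [pageEntry, pageEntry, dif_neg h, dif_neg fun h' => h h'.symm]

theorem pageEntry_pos {x y : Fin I.n} : 0 < I.pageEntry x y ↔ I.H.Adj x y := by
  rw [pageEntry]
  split_ifs with h <;> simp [h]

theorem pageEntry_sub_one_lt (x y : Fin I.n) : I.pageEntry x y - 1 < I.ℓ := by
  have := I.one_le_ℓ
  rw [pageEntry]
  split_ifs with h
  · have := (I.layoutH.page (edgeOf I.H.coe (x := ⟨x, I.H.edge_vert h⟩)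
      (y := ⟨y, I.H.edge_vert h.symm⟩) h)).2
    omega
  · omega

theorem not_nest_of_pageEntry_eq {a b c d : Fin I.n} (hab : I.H.Adj a b) (hcd : I.H.Adj c d)
    (h : I.pageEntry a b = I.pageEntry c d) :
    ¬ Nest (3 * I.spineEntry a) (3 * I.spineEntry b) (3 * I.spineEntry c) (3 * I.spineEntry d) := by
  have hpos : ∀ x y : I.H.verts, I.layoutH.spine x y ↔ 3 * I.spineEntry x < 3 * I.spineEntry y :=
    fun x y => by rw [spine_iff_spineEntry]; omega
  have hinj := injective_of_lt_iff I.layoutH.strictTotal hpos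
  rw [pageEntry, pageEntry, dif_pos hab, dif_pos hcd] at h
  have key : ∀ {a b c d : Fin I.n} (hab : I.H.Adj a b) (hcd : I.H.Adj c d),
      I.layoutH.page (edgeOf I.H.coe (x := ⟨a, I.H.edge_vert hab⟩)
        (y := ⟨b, I.H.edge_vert hab.symm⟩) hab) = I.layoutH.page (edgeOf I.H.coe
        (x := ⟨c, I.H.edge_vert hcd⟩) (y := ⟨d, I.H.edge_vert hcd.symm⟩) hcd) →
      ¬ (Btw (3 * I.spineEntry a) (3 * I.spineEntry b) (3 * I.spineEntry c) ∧
        Btw (3 * I.spineEntry a) (3 * I.spineEntry b) (3 * I.spineEntry d)) :=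
    fun {a b c d} hab hcd h hn => I.layoutH.not_nests _ _ h <|
      (nests_iff hinj hpos (a := ⟨a, I.H.edge_vert hab⟩) (b := ⟨b, I.H.edge_vert hab.symm⟩)
        (c := ⟨c, I.H.edge_vert hcd⟩) (d := ⟨d, I.H.edge_vert hcd.symm⟩)
        (fun h' => hcd.ne (congrArg Subtype.val h'))).2 hn
  exact not_or_intro (key hab hcd (Fin.ext (Nat.succ_injective h)))
    (key hcd hab (Fin.ext (Nat.succ_injective h.symm)))

/-! ### Placing the two missing vertices. -/

/-- The subgraph arises from the whole graph by deleting the vertices `u` and `v`. -/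
structure Missing (I : Instance) (u v : Fin I.n) : Prop where
  ne : u ≠ v
  mem_verts : ∀ x, x ∈ I.H.verts ↔ x ≠ u ∧ x ≠ v
  adj : ∀ x y, I.H.Adj x y ↔ I.G.Adj x y ∧ x ∈ I.H.verts ∧ y ∈ I.H.verts

theorem TwoMissingVertices.exists_missing (h : I.TwoMissingVertices) : ∃ u v, I.Missing u v := by
  obtain ⟨u, v, huv, hH⟩ := h
  refine ⟨u, v, huv, fun x => ?_, fun x y => ?_⟩
  · simp [hH]
  · rw [hH]
    simp only [SimpleGraph.Subgraph.deleteVerts_adj, SimpleGraph.Subgraph.deleteVerts_verts,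
      SimpleGraph.Subgraph.verts_top, SimpleGraph.Subgraph.top_adj, Set.mem_sdiff, Set.mem_univ,
      true_and]
    tauto

theorem Missing.swap {u v : Fin I.n} (h : I.Missing u v) : I.Missing v u :=
  ⟨h.ne.symm, fun x => (h.mem_verts x).trans and_comm, h.adj⟩

/-- The positions of all vertices if the new vertices `u` and `v` are placed after the old
vertices number `i` and `j`, respectively. -/
noncomputable def place (I : Instance) (u v : Fin I.n) (i j : ℕ) (x : Fin I.n) : ℕ :=
  if x = u then 3 * i + 1 else if x = v then 3 * j + 2 else 3 * I.spineEntry x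

section Place

variable {u v : Fin I.n} {i j : ℕ}

theorem place_left : I.place u v i j u = 3 * i + 1 := if_pos rfl

theorem Missing.place_right (h : I.Missing u v) : I.place u v i j v = 3 * j + 2 := by
  rw [place, if_neg h.ne.symm, if_pos rfl]

theorem Missing.place_old (h : I.Missing u v) {x : Fin I.n} (hx : x ∈ I.H.verts) :
    I.place u v i j x = 3 * I.spineEntry x := by
  rw [place, if_neg ((h.mem_verts x).1 hx).1, if_neg ((h.mem_verts x).1 hx).2]

theorem Missing.cases (h : I.Missing u v) (x : Fin I.n) : x = u ∨ x = v ∨ x ∈ I.H.verts := by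
  rw [h.mem_verts]; tauto

/-- To prove a symmetric statement about all edges, consider the edge `uv`, the edges from `u` or
`v` to old vertices, and the old edges. -/
theorem Missing.edge_cases (h : I.Missing u v) {R : Fin I.n → Fin I.n → Prop}
    (hsymm : ∀ x y, R x y → R y x) (huv : I.G.Adj u v → R u v)
    (hu : ∀ x ∈ I.H.verts, I.G.Adj u x → R u x) (hv : ∀ x ∈ I.H.verts, I.G.Adj v x → R v x)
    (hold : ∀ x y, I.H.Adj x y → R x y) (x y : Fin I.n) (hxy : I.G.Adj x y) : R x y := by
  rcases h.cases x with rfl | rfl | hx <;> rcases h.cases y with rfl | rfl | hy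
  · exact absurd rfl hxy.ne
  · exact huv hxy
  · exact hu y hy hxy
  · exact hsymm _ _ (huv hxy.symm)
  · exact absurd rfl hxy.ne
  · exact hv y hy hxy
  · exact hsymm _ _ (hu x hx hxy.symm)
  · exact hsymm _ _ (hv x hx hxy.symm)
  · exact hold x y ((h.adj x y).2 ⟨hxy, hx, hy⟩)

theorem Missing.place_injective (h : I.Missing u v) : Function.Injective (I.place u v i j) := by
  intro x y hxy
  rcases h.cases x with rfl | rfl | hx <;> rcases h.cases y with rfl | rfl | hy <;>
    simp only [place_left, h.place_right, h.place_old, *] at hxy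
  all_goals first | rfl | omega | exact spineEntry_injOn hx hy (by omega)

/-- Every extension can be brought into the form described by `place`. -/
theorem IsExtension.exists_place (h : I.Missing u v) {pos : Fin I.n → ℕ}
    {col : Fin I.n → Fin I.n → ℕ} (hp : I.IsExtension pos col) (huv : pos u < pos v) :
    ∃ i < I.n, ∃ j < I.n, i ≤ j ∧ I.IsExtension (I.place u v i j) col := by
  let cnt : Fin I.n → ℕ := fun x => {y | y ∈ I.H.verts ∧ pos y < pos x}.ncard
  have hmono : ∀ x y, pos x < pos y → cnt x ≤ cnt y := fun x y hxy =>
    Set.ncard_le_ncard (fun z hz => ⟨hz.1, hz.2.trans hxy⟩) (Set.toFinite _)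
  have hstrict : ∀ x y, x ∈ I.H.verts → pos x < pos y → cnt x < cnt y := fun x y hx hxy =>
    Set.ncard_lt_ncard ⟨fun z hz => ⟨hz.1, hz.2.trans hxy⟩, fun hs => lt_irrefl _ (hs ⟨hx, hxy⟩).2⟩
      (Set.toFinite _)
  have hlt : ∀ x, cnt x < I.n := fun x => by
    have : cnt x < (Set.univ : Set (Fin I.n)).ncard :=
      Set.ncard_lt_ncard ⟨Set.subset_univ _, fun hs => lt_irrefl _ (hs (Set.mem_univ x)).2⟩
        (Set.toFinite _)
    simpa using this
  have hold : ∀ x ∈ I.H.verts, I.spineEntry x = cnt x + 1 := fun x hx => by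
    rw [spineEntry, dif_pos hx, ← Set.ncard_image_of_injective _ Subtype.val_injective]
    congr 2
    ext y
    simp only [Set.mem_image, Set.mem_ofPred_eq, hp.spine, Subtype.exists]
    constructor
    · rintro ⟨z, hz, hzx, rfl⟩
      exact ⟨hz, hzx⟩
    · rintro ⟨hy, hyx⟩
      exact ⟨y, hy, hyx, rfl⟩
  -- An old vertex `x` stands at `3 * (cnt x + 1)`, so `3 * cnt u + 1` falls into the gap after the
  -- first `cnt u` old vertices. If both new vertices share a gap, the remainders `1` and `2` keep
  -- `u` before `v`.
  refine ⟨cnt u, hlt u, cnt v, hlt v, hmono u v huv, hp.congr ?_⟩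
  have key : ∀ x y, pos x < pos y → I.place u v (cnt u) (cnt v) x < I.place u v (cnt u) (cnt v) y := by
    intro x y hxy
    have h1 := hmono x y hxy
    have h2 := hstrict x y
    rcases h.cases x with rfl | rfl | hx <;> rcases h.cases y with rfl | rfl | hy <;>
      simp only [place_left, h.place_right, h.place_old, *]
    all_goals first | omega | (have := h2 hx hxy; omega)
  refine fun x y => ⟨key x y, fun hxy => ?_⟩
  rcases lt_trichotomy (pos x) (pos y) with h' | h' | h'
  · exact h'
  · exact absurd (hp.injective h' ▸ hxy) (lt_irrefl _)
  · exact absurd (key y x h') hxy.not_gt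

end Place

end Instance

/-! ### Extensions with a fixed placement versus page assignments. -/

namespace Instance

variable {I : Instance} {u v : Fin I.n} {i j : ℕ}

theorem mem_verts_iff_spW (x : Fin I.n) : 0 < spW I.input x ↔ x ∈ I.H.verts := by
  rw [spW_input, Nat.pos_iff_ne_zero, Ne, spineEntry_eq_zero, not_not]

theorem posW_input (x : Fin I.n) : posW I.input x = 3 * I.spineEntry x := by
  rw [posW, spW_input]

/-- A new edge can be put on page `p` without a nesting relation to an old edge. -/
theorem allowed_input_iff {a b p : ℕ} :
    Allowed I.n (pgW I.input) (posW I.input) a b p ↔ ∀ c d, I.pageEntry c d = p + 1 →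
      ¬ Nest a b (3 * I.spineEntry c) (3 * I.spineEntry d) := by
  refine ⟨fun h c d hcd => ?_, fun h c hc d hd hcd => ?_⟩
  · rw [← posW_input, ← posW_input]
    exact h c c.2 d d.2 (by rw [pgW_input, hcd])
  · have := h ⟨c, hc⟩ ⟨d, hd⟩ (by rw [← pgW_input, ← hcd])
    rwa [← posW_input, ← posW_input] at this

/-- Pages for the edges at the new vertices that are compatible with each other and with the given
layout. -/
def Pages (u v : Fin I.n) (i j : ℕ) (f g : ℕ → ℕ) : Prop :=
  (∀ x ∈ I.H.verts, I.G.Adj u x → f (3 * I.spineEntry x) < I.ℓ ∧ Allowed I.n (pgW I.input)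
    (posW I.input) (3 * i + 1) (3 * I.spineEntry x) (f (3 * I.spineEntry x))) ∧
  (∀ y ∈ I.H.verts, I.G.Adj v y → g (3 * I.spineEntry y) < I.ℓ ∧ Allowed I.n (pgW I.input)
    (posW I.input) (3 * j + 2) (3 * I.spineEntry y) (g (3 * I.spineEntry y))) ∧
  ∀ x ∈ I.H.verts, I.G.Adj u x → ∀ y ∈ I.H.verts, I.G.Adj v y →
    Nest (3 * i + 1) (3 * I.spineEntry x) (3 * j + 2) (3 * I.spineEntry y) →
    f (3 * I.spineEntry x) ≠ g (3 * I.spineEntry y)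

theorem placementCriterion_iff_pages (hij : i ≤ j) (hj : j < I.n) :
    PlacementCriterion I.input u v i j ↔
      (I.G.Adj u v → ∃ p < I.ℓ, Allowed I.n (pgW I.input) (posW I.input) (3 * i + 1) (3 * j + 2) p) ∧
      ∃ f g, Pages u v i j f g := by
  have hmod : ∀ x, posW I.input x = 3 * spW I.input x := fun _ => rfl
  rw [PlacementCriterion, input_zero, input_one, adjW_input]
  refine and_congr_right fun _ => ?_
  have hn := I.input_one
  -- Old positions are multiples of `3`, new ones have remainders `1` and `2`, and the mirror
  -- constant `3 * n + 3` exceeds them all.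
  refine (starCriterion_both (by omega) (fun x _ => ?_) (fun x _ => ?_) (by omega)
    fun x hx => ?_).trans ?_
  · rw [hmod]; omega
  · rw [hmod]; omega
  · have := I.spineEntry_le ⟨x, hx⟩
    rw [← spW_input] at this
    rw [hmod]
    dsimp only at this
    omega
  · simp only [Pages, Fin.forall_iff]
    refine exists_congr fun f => exists_congr fun g => ?_
    have hsp : ∀ x (hx : x < I.n), (0 < spW I.input x ↔ (⟨x, hx⟩ : Fin I.n) ∈ I.H.verts) :=
      fun x hx => mem_verts_iff_spW ⟨x, hx⟩
    have hadj : ∀ (z : Fin I.n) x (hx : x < I.n), (adjW I.input z x ↔ I.G.Adj z ⟨x, hx⟩) :=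
      fun z x hx => adjW_input I z ⟨x, hx⟩
    have hpos : ∀ x (hx : x < I.n), posW I.input x = 3 * I.spineEntry ⟨x, hx⟩ :=
      fun x hx => posW_input ⟨x, hx⟩
    refine and_congr ?_ (and_congr ?_ ?_)
    · exact forall₂_congr fun x hx => by rw [hsp x hx, hadj u x hx, hpos x hx]
    · exact forall₂_congr fun x hx => by rw [hsp x hx, hadj v x hx, hpos x hx]
    · refine forall₂_congr fun x hx => ?_
      rw [hsp x hx, hadj u x hx, hpos x hx]
      refine forall₂_congr fun _ _ => forall₂_congr fun y hy => ?_
      rw [hsp y hy, hadj v y hy, hpos y hy]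

/-- The page numbers of all edges, given a page for `uv` and pages for the edges from `u` and `v`
to the old vertices. -/
noncomputable def color (u v : Fin I.n) (r : ℕ) (f g : ℕ → ℕ) (x y : Fin I.n) : ℕ :=
  if x = u then (if y = v then r else f (3 * I.spineEntry y))
  else if x = v then (if y = u then r else g (3 * I.spineEntry y))
  else if y = u then f (3 * I.spineEntry x)
  else if y = v then g (3 * I.spineEntry x)
  else I.pageEntry x y - 1

theorem Missing.isExtension_of_pages (h : I.Missing u v) {r : ℕ} {f g : ℕ → ℕ}
    (hr : I.G.Adj u v →
      r < I.ℓ ∧ Allowed I.n (pgW I.input) (posW I.input) (3 * i + 1) (3 * j + 2) r)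
    (hfg : Pages u v i j f g) : I.IsExtension (I.place u v i j) (color u v r f g) := by
  obtain ⟨hf, hg, hfg⟩ := hfg
  have hu : ∀ {x}, x ∈ I.H.verts → x ≠ u := fun hx => ((h.mem_verts _).1 hx).1
  have hv : ∀ {x}, x ∈ I.H.verts → x ≠ v := fun hx => ((h.mem_verts _).1 hx).2
  have cuv : color u v r f g u v = r := by simp [color]
  have cu : ∀ {x}, x ∈ I.H.verts → color u v r f g u x = f (3 * I.spineEntry x) := fun hx => by
    simp [color, hv hx]
  have cv : ∀ {x}, x ∈ I.H.verts → color u v r f g v x = g (3 * I.spineEntry x) := fun hx => by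
    simp [color, hu hx, h.ne.symm]
  have cold : ∀ {x y}, I.H.Adj x y → color u v r f g x y = I.pageEntry x y - 1 := fun hxy => by
    have hx := I.H.edge_vert hxy
    have hy := I.H.edge_vert hxy.symm
    simp [color, hu hx, hu hy, hv hx, hv hy]
  have hsymm : ∀ x y, color u v r f g x y = color u v r f g y x := fun x y => by
    have := I.pageEntry_comm x y
    have := h.ne
    unfold color
    split_ifs <;> simp_all
  have hpage : ∀ x y, I.H.Adj x y → I.pageEntry x y = color u v r f g x y + 1 := fun x y hxy => by
    have := pageEntry_pos.2 hxy
    rw [cold hxy]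
    omega
  refine ⟨h.place_injective, fun x y => ?_, hsymm, ?_, hpage, ?_⟩
  · rw [h.place_old x.2, h.place_old y.2, spine_iff_spineEntry]
    omega
  · refine h.edge_cases (fun x y hxy => hsymm x y ▸ hxy) (fun huv => ?_) (fun x hx hux => ?_)
      (fun x hx hvx => ?_) fun x y hxy => ?_
    · rw [cuv]
      exact (hr huv).1
    · rw [cu hx]
      exact (hf x hx hux).1
    · rw [cv hx]
      exact (hg x hx hvx).1
    · rw [cold hxy]
      exact I.pageEntry_sub_one_lt x y
  · have hold : ∀ {a b p c d}, Allowed I.n (pgW I.input) (posW I.input) a b p → I.H.Adj c d →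
        p = color u v r f g c d →
        ¬ Nest a b (I.place u v i j c) (I.place u v i j d) := fun hall hcd hp => by
      rw [h.place_old (I.H.edge_vert hcd), h.place_old (I.H.edge_vert hcd.symm)]
      exact allowed_input_iff.1 hall _ _ (by rw [hpage _ _ hcd, hp])
    -- The two edges are separated so that `edge_cases` applies to each in turn.
    suffices key : ∀ a b, I.G.Adj a b → ∀ c d, I.G.Adj c d →
        color u v r f g a b = color u v r f g c d → ¬ Nest (I.place u v i j a) (I.place u v i j b)
          (I.place u v i j c) (I.place u v i j d) from
      fun a b c d hab hcd => key a b hab c d hcd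
    have hsymm' : ∀ a b, (∀ x y, I.G.Adj x y → color u v r f g a b = color u v r f g x y →
        ¬ Nest (I.place u v i j a) (I.place u v i j b) (I.place u v i j x) (I.place u v i j y)) →
        ∀ x y, I.G.Adj x y → color u v r f g b a = color u v r f g x y →
        ¬ Nest (I.place u v i j b) (I.place u v i j a) (I.place u v i j x) (I.place u v i j y) :=
      fun a b hab x y hxy hc hn => hab x y hxy (hsymm b a ▸ hc) hn.swap_left
    have hsymm'' : ∀ a b x y, (color u v r f g a b = color u v r f g x y →
        ¬ Nest (I.place u v i j a) (I.place u v i j b) (I.place u v i j x) (I.place u v i j y)) →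
        color u v r f g a b = color u v r f g y x →
        ¬ Nest (I.place u v i j a) (I.place u v i j b) (I.place u v i j y) (I.place u v i j x) :=
      fun a b x y hxy hc hn => hxy (hsymm y x ▸ hc) hn.comm.swap_left.comm
    refine h.edge_cases hsymm' (fun huv => ?_) (fun x hx hux => ?_) (fun x hx hvx => ?_)
      fun x y hxy => ?_
    -- Against a new edge there is a common endpoint, which strict betweenness rules out; only old
    -- edges matter.
    · refine h.edge_cases (hsymm'' _ _) ?_ ?_ ?_ ?_
      · intro _ _ hn
        simp only [Nest, Btw] at hn
        omega
      · intro y _ _ _ hn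
        simp only [Nest, Btw] at hn
        omega
      · intro y _ _ _ hn
        simp only [Nest, Btw] at hn
        omega
      · intro c d hcd hc
        rw [cuv] at hc
        rw [place_left, h.place_right]
        exact hold (hr huv).2 hcd hc
    · refine h.edge_cases (hsymm'' _ _) ?_ ?_ ?_ ?_
      · intro _ _ hn
        simp only [Nest, Btw] at hn
        omega
      · intro y _ _ _ hn
        simp only [Nest, Btw] at hn
        omega
      · intro y hy hvy hc hn
        rw [cu hx, cv hy] at hc
        rw [place_left, h.place_right, h.place_old hx, h.place_old hy] at hn
        exact hfg x hx hux y hy hvy hn hc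
      · intro c d hcd hc
        rw [cu hx] at hc
        rw [place_left, h.place_old hx]
        exact hold (hf x hx hux).2 hcd hc
    · refine h.edge_cases (hsymm'' _ _) ?_ ?_ ?_ ?_
      · intro _ _ hn
        simp only [Nest, Btw] at hn
        omega
      · intro y hy huy hc hn
        rw [cu hy, cv hx] at hc
        rw [place_left, h.place_right, h.place_old hx, h.place_old hy] at hn
        exact hfg y hy huy x hx hvx hn.comm hc.symm
      · intro y _ _ _ hn
        simp only [Nest, Btw] at hn
        omega
      · intro c d hcd hc
        rw [cv hx] at hc
        rw [h.place_right, h.place_old hx]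
        exact hold (hg x hx hvx).2 hcd hc
    · have hx := I.H.edge_vert hxy
      have hy := I.H.edge_vert hxy.symm
      refine h.edge_cases (hsymm'' _ _) ?_ ?_ ?_ ?_
      · intro huv hc hn
        rw [cuv] at hc
        refine hold (hr huv).2 hxy hc.symm ?_
        rw [← h.place_right, ← place_left (u := u) (v := v) (i := i) (j := j)]
        exact hn.comm
      · intro z hz huz hc hn
        rw [cu hz] at hc
        refine hold (hf z hz huz).2 hxy hc.symm ?_
        rw [← h.place_old hz, ← place_left (u := u) (v := v) (i := i) (j := j)]
        exact hn.comm
      · intro z hz hvz hc hn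
        rw [cv hz] at hc
        refine hold (hg z hz hvz).2 hxy hc.symm ?_
        rw [← h.place_old hz, ← h.place_right]
        exact hn.comm
      · intro c d hcd hc
        rw [h.place_old hx, h.place_old hy, h.place_old (I.H.edge_vert hcd),
          h.place_old (I.H.edge_vert hcd.symm)]
        exact not_nest_of_pageEntry_eq hxy hcd (by rw [hpage _ _ hxy, hpage _ _ hcd, hc])

theorem Missing.pages_of_isExtension (h : I.Missing u v) {col : Fin I.n → Fin I.n → ℕ}
    (hE : I.IsExtension (I.place u v i j) col) :
    (I.G.Adj u v → ∃ p < I.ℓ, Allowed I.n (pgW I.input) (posW I.input) (3 * i + 1) (3 * j + 2) p) ∧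
      ∃ f g, Pages u v i j f g := by
  have : Nonempty (Fin I.n) := ⟨u⟩
  have hallow : ∀ a b, I.G.Adj a b → Allowed I.n (pgW I.input) (posW I.input)
      (I.place u v i j a) (I.place u v i j b) (col a b) := fun a b hab => by
    refine allowed_input_iff.2 fun c d hcd => ?_
    have hadj : I.H.Adj c d := pageEntry_pos.1 (by omega)
    rw [← h.place_old (i := i) (j := j) (I.H.edge_vert hadj),
      ← h.place_old (i := i) (j := j) (I.H.edge_vert hadj.symm)]
    refine hE.not_nest a b c d hab (I.H.adj_sub hadj) ?_
    have := hE.page c d hadj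
    omega
  -- `Pages` indexes pages by position; injectivity of `place` recovers the vertex.
  have hinv : ∀ x ∈ I.H.verts, Function.invFun (I.place u v i j) (3 * I.spineEntry x) = x :=
    fun x hx => by
      rw [← h.place_old hx]
      exact Function.leftInverse_invFun hE.injective x
  refine ⟨fun huv => ⟨col u v, hE.lt u v huv, ?_⟩,
    fun z => col u (Function.invFun (I.place u v i j) z),
    fun z => col v (Function.invFun (I.place u v i j) z), fun x hx hux => ?_, fun y hy hvy => ?_,
    fun x hx hux y hy hvy hn => ?_⟩
  · have := hallow u v huv
    rwa [place_left, h.place_right] at this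
  · have := hallow u x hux
    rw [place_left, h.place_old hx] at this
    dsimp only
    rw [hinv x hx]
    exact ⟨hE.lt u x hux, this⟩
  · have := hallow v y hvy
    rw [h.place_right, h.place_old hy] at this
    dsimp only
    rw [hinv y hy]
    exact ⟨hE.lt v y hvy, this⟩
  · dsimp only
    rw [hinv x hx, hinv y hy]
    intro hc
    refine hE.not_nest u x v y hux hvy hc ?_
    rwa [place_left, h.place_right, h.place_old hx, h.place_old hy]

theorem Missing.placementCriterion_iff (h : I.Missing u v) (hij : i ≤ j) (hj : j < I.n) :
    PlacementCriterion I.input u v i j ↔ ∃ col, I.IsExtension (I.place u v i j) col := by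
  rw [placementCriterion_iff_pages hij hj]
  constructor
  · rintro ⟨hr, f, g, hfg⟩
    by_cases huv : I.G.Adj u v
    · obtain ⟨r, hr⟩ := hr huv
      exact ⟨_, h.isExtension_of_pages (fun _ => hr) hfg⟩
    · exact ⟨_, h.isExtension_of_pages (r := 0) (fun huv' => absurd huv' huv) hfg⟩
  · rintro ⟨col, hE⟩
    exact h.pages_of_isExtension hE

/-- Spine entry `0` identifies the missing vertices. The criterion tries them in both roles, which
is why it may assume that `u` comes before `v`. -/
theorem TwoMissingVertices.inputCriterion_iff (hI : I.TwoMissingVertices) :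
    InputCriterion I.input ↔ I.IsPositive := by
  obtain ⟨u₀, v₀, h₀⟩ := hI.exists_missing
  rw [isPositive_iff, InputCriterion, input_one]
  constructor
  · rintro ⟨u, hu, v, hv, huv, hu0, hv0, i, -, j, hj, hij, hp⟩
    have hu' : (⟨u, hu⟩ : Fin I.n) ∉ I.H.verts := by
      rwa [← spineEntry_eq_zero, ← spW_input]
    have hv' : (⟨v, hv⟩ : Fin I.n) ∉ I.H.verts := by
      rwa [← spineEntry_eq_zero, ← spW_input]
    have h : I.Missing ⟨u, hu⟩ ⟨v, hv⟩ := by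
      have hne : (⟨u, hu⟩ : Fin I.n) ≠ ⟨v, hv⟩ := fun h => huv (congrArg Fin.val h)
      rcases h₀.cases ⟨u, hu⟩ with h1 | h1 | h1 <;> rcases h₀.cases ⟨v, hv⟩ with h2 | h2 | h2
      · exact absurd (h1.trans h2.symm) hne
      · exact h1 ▸ h2 ▸ h₀
      · exact absurd h2 hv'
      · exact h1 ▸ h2 ▸ h₀.swap
      · exact absurd (h1.trans h2.symm) hne
      · exact absurd h2 hv'
      all_goals exact absurd h1 hu'
    obtain ⟨col, hE⟩ := (h.placementCriterion_iff hij hj).1 hp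
    exact ⟨_, col, hE⟩
  · rintro ⟨pos, col, hE⟩
    obtain ⟨u, v, h, huv⟩ : ∃ u v, I.Missing u v ∧ pos u < pos v := by
      rcases (hE.injective.ne h₀.ne).lt_or_gt with h | h
      · exact ⟨u₀, v₀, h₀, h⟩
      · exact ⟨v₀, u₀, h₀.swap, h⟩
    obtain ⟨i, hi, j, hj, hij, hE'⟩ := hE.exists_place h huv
    refine ⟨u, u.2, v, v.2, fun hc => h.ne (Fin.ext hc), ?_, ?_, i, hi, j, hj, hij,
      (h.placementCriterion_iff hij hj).2 ⟨col, hE'⟩⟩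
    · rw [spW_input, spineEntry_eq_zero, h.mem_verts]
      exact fun hc => hc.1 rfl
    · rw [spW_input, spineEntry_eq_zero, h.mem_verts]
      exact fun hc => hc.2 rfl

end Instance

end QueueLayoutExtension

theorem mainTheorem3 :
    RAM.SolvableInPolyTime QueueLayoutExtension.Instance.encode
      QueueLayoutExtension.Instance.size
      QueueLayoutExtension.Instance.TwoMissingVertices
      QueueLayoutExtension.Instance.IsPositive :=
  RAM.solvableInPolyTime_of_formula QueueLayoutExtension.inputF
    (fun _ _ _ hx => QueueLayoutExtension.Instance.encode_le_size _ hx) fun _ hI =>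
    (QueueLayoutExtension.holds_inputF _).trans hI.inputCriterion_iff
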